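/- Let $X$ be a complex Banach space and let $T$ be a bounded linear operator on $X$; $\mathcal N$ and $\mathcal R$ denote kernel and range. A bounded operator $S$ on a complex Banach space $Y$ is *semi-Fredholm* if either $\mathcal R(S)$ is closed and $\dim\mathcal N(S)<\infty$, or $\operatorname{codim}\mathcal R(S)<\infty$; its index is then $\operatorname{ind}(S)=\dim\mathcal N(S)-\operatorname{codim}\mathcal R(S)\in\mathbb Z\cup\{\pm\infty\}$. The operator $S$ is *semi-regular* if $\mathcal R(S)$ is closed and $\mathcal N(S)\subseteq\bigcap_{n\ge 0}\mathcal R(S^n)$, and *quasi-nilpotent* if $\sigma(S)\subseteq\{0\}$. Write $(M,N)\in\mathrm{Red}(T)$ if $M$ and $N$ are closed $T$-invariant subspaces of $X$ with $X=M\oplus N$; let $T_M$, $T_N$ be the restrictions of $T$ to operators on $M$, $N$. For $n\ge 0$ let $T_{[n]}:\mathcal R(T^n)\to\mathcal R(T^n)$ be the restriction of $T$. - $T$ is *semi-B-Fredholm* if for some integer $n\ge0$ the range $\mathcal R(T^n)$ is closed and $T_{[n]}$ is semi-Fredholm; its index as a semi-B-Fredholm operator is $\operatorname{ind}(T_{[n]})$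 for any such $n$. - $T$ is *pseudo-Fredholm* if there is $(M,N)\in\mathrm{Red}(T)$ with $T_M$ semi-regular and $T_N$ quasi-nilpotent. - $T$ is *pseudo semi-B-Fredholm* if there is $(M,N)\in\mathrm{Red}(T)$ with $T_M$ semi-Fredholm and $T_N$ quasi-nilpotent; its index as a pseudo semi-B-Fredholm operator is $\operatorname{ind}(T_M)$ for any such pair. Then $T$ is both semi-B-Fredholm and pseudo-Fredholm if and only if there is $(M,N)\in\mathrm{Red}(T)$ such that $T_M$ is semi-Fredholm and $T_N$ is nilpotent. In that case $T$ is pseudo semi-B-Fredholm, its index as a semi-B-Fredholm operator and its index as a pseudo semi-B-Fredholm operator are both well defined (independent of the choice of $n$ and of $(M,N)$, respectively), and the two indices coincide. -/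

import Mathlib

namespace FredholmTheory

section Operators

variable {E : Type*} [NormedAddCommGroup E] [NormedSpace ℂ E]

/-- Upper semi-Fredholm: closed range and finite-dimensional kernel. -/
def IsUpperSemiFredholm (S : E →L[ℂ] E) : Prop :=
  IsClosed (S.range : Set E) ∧ FiniteDimensional ℂ S.ker

/-- Lower semi-Fredholm: range of finite codimension. -/
def IsLowerSemiFredholm (S : E →L[ℂ] E) : Prop :=
  FiniteDimensional ℂ (E ⧸ S.range)

def IsSemiFredholm (S : E →L[ℂ] E) : Prop :=
  IsUpperSemiFredholm S ∨ IsLowerSemiFredholm S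

/-- The nullity, as a natural number or `∞`. -/
noncomputable def nullity (S : E →L[ℂ] E) : ℕ∞ :=
  Cardinal.toENat (Module.rank ℂ S.ker)

/-- The deficiency, as a natural number or `∞`. -/
noncomputable def deficiency (S : E →L[ℂ] E) : ℕ∞ :=
  Cardinal.toENat (Module.rank ℂ (E ⧸ S.range))

/-- The index `dim ker S - codim range S`, an integer or `±∞`. It is only used for semi-Fredholm
operators, for which at least one of the two terms is finite. -/
noncomputable def index (S : E →L[ℂ] E) : EReal :=
  ((nullity S : ENNReal) : EReal) - ((deficiency S : ENNReal) : EReal)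

/-- Semi-regular: closed range, and the kernel is contained in the range of every power. -/
def IsSemiRegular (S : E →L[ℂ] E) : Prop :=
  IsClosed (S.range : Set E) ∧ ∀ n : ℕ, S.ker ≤ (S ^ n).range

/-- Quasi-nilpotent: the spectrum contains no point other than `0`. (It equals `{0}` on a nonzero
Banach space and is empty on the zero space.) -/
def IsQuasiNilpotent (S : E →L[ℂ] E) : Prop :=
  spectrum ℂ S ⊆ {0}

theorem mapsTo_range_pow (T : E →L[ℂ] E) (n : ℕ) :
    ∀ x ∈ (T ^ n).range, T x ∈ (T ^ n).range := by
  rintro x ⟨y, rfl⟩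
  refine ⟨T y, ?_⟩
  change (T ^ n * T) y = (T * T ^ n) y
  rw [← pow_succ, ← pow_succ']

/-- The operator `T_[n]` that `T` induces on the range of `T ^ n`. -/
def rangeRestriction (T : E →L[ℂ] E) (n : ℕ) : (T ^ n).range →L[ℂ] (T ^ n).range :=
  T.restrict (mapsTo_range_pow T n)

/-- The range of `T ^ n` is closed and `T_[n]` is semi-Fredholm. -/
def IsSemiBFredholmAt (T : E →L[ℂ] E) (n : ℕ) : Prop :=
  IsClosed ((T ^ n).range : Set E) ∧ IsSemiFredholm (rangeRestriction T n)

def IsSemiBFredholm (T : E →L[ℂ] E) : Prop :=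
  ∃ n : ℕ, IsSemiBFredholmAt T n

/-- `k` is a value of the index of the semi-B-Fredholm operator `T`: the index of `T_[n]` for some
`n` such that the range of `T ^ n` is closed and `T_[n]` is semi-Fredholm. -/
def IsSemiBFredholmIndex (T : E →L[ℂ] E) (k : EReal) : Prop :=
  ∃ n : ℕ, IsSemiBFredholmAt T n ∧ index (rangeRestriction T n) = k

/-- `T` is completely reduced by `(M, N)`: both are closed `T`-invariant subspaces and the space
is their direct sum. -/
structure Red (T : E →L[ℂ] E) (M N : Submodule ℂ E) : Prop where
  isClosed_left : IsClosed (M : Set E)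
  isClosed_right : IsClosed (N : Set E)
  mapsTo_left : ∀ x ∈ M, T x ∈ M
  mapsTo_right : ∀ x ∈ N, T x ∈ N
  isCompl : IsCompl M N

/-- There is a pair `(M, N)` reducing `T` with `T_M` semi-regular and `T_N` quasi-nilpotent. -/
def IsPseudoFredholm (T : E →L[ℂ] E) : Prop :=
  ∃ (M N : Submodule ℂ E) (h : Red T M N),
    IsSemiRegular (T.restrict h.mapsTo_left) ∧ IsQuasiNilpotent (T.restrict h.mapsTo_right)

/-- There is a pair `(M, N)` reducing `T` with `T_M` semi-Fredholm and `T_N` quasi-nilpotent. -/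
def IsPseudoSemiBFredholm (T : E →L[ℂ] E) : Prop :=
  ∃ (M N : Submodule ℂ E) (h : Red T M N),
    IsSemiFredholm (T.restrict h.mapsTo_left) ∧ IsQuasiNilpotent (T.restrict h.mapsTo_right)

/-- `k` is a value of the index of the pseudo semi-B-Fredholm operator `T`: the index of `T_M` for
some pair `(M, N)` reducing `T` with `T_M` semi-Fredholm and `T_N` quasi-nilpotent. -/
def IsPseudoSemiBFredholmIndex (T : E →L[ℂ] E) (k : EReal) : Prop :=
  ∃ (M N : Submodule ℂ E) (h : Red T M N),
    IsSemiFredholm (T.restrict h.mapsTo_left) ∧ IsQuasiNilpotent (T.restrict h.mapsTo_right) ∧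
      index (T.restrict h.mapsTo_left) = k

/-- `T` is the direct sum of a semi-Fredholm operator and a nilpotent operator. -/
def IsSemiFredholmSumNilpotent (T : E →L[ℂ] E) : Prop :=
  ∃ (M N : Submodule ℂ E) (h : Red T M N),
    IsSemiFredholm (T.restrict h.mapsTo_left) ∧ IsNilpotent (T.restrict h.mapsTo_right)

end Operators

end FredholmTheory

/-! Suppose `T` is semi-B-Fredholm at `n` and `(M, N)` is a pair with `T_M` semi-regular and `T_N`
quasi-nilpotent. The kernel of `T_M` lies in the range of `T ^ n`, and `T ^ n` embeds the cokernel
of `T_M` into that of `T_[n]`, so `T_M` is semi-Fredholm (`IsSemiBFredholmAt.isSemiFredholm_left`).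
The restriction of `T` to `N ∩ R(T ^ n)` is a direct summand of `T_[n]`, hence semi-Fredholm, and it
is quasi-nilpotent; such an operator is nilpotent, and therefore so is `T_N`
(`IsSemiBFredholmAt.isNilpotent_right`).

Conversely, if `T_M` is semi-Fredholm and `T ^ d` kills `N`, then `R(T ^ d)` lies in `M` and `T_[d]`
inherits the semi-Fredholm property (`Red.isSemiBFredholmAt`). Kato's decomposition
(`IsSemiFredholm.exists_kato`) splits `T_M` into a semi-regular and a nilpotent part; moving the
latter into `N` shows that `T` is pseudo-Fredholm.

For the indices, `T - c` with `c ≠ 0` is bijective modulo `R(T ^ n)` and modulo `M`, so it has the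
same index as `T_[n] - c` and `T_M - c`. The index is stable under small perturbations, so every
admissible `T_[n]` and `T_M` has the index of `T - c` for all small `c ≠ 0`, which depends on `T`
alone. -/

namespace FredholmTheory

/-! ### Algebraic kernel and cokernel dimensions. -/

section Algebra

universe u
variable {U V W : Type u} [AddCommGroup U] [Module ℂ U] [AddCommGroup V] [Module ℂ V]
  [AddCommGroup W] [Module ℂ W]

/-- The dimension of the kernel, as a natural number or `∞`. -/
noncomputable def kernelDim (f : V →ₗ[ℂ] W) : ℕ∞ :=
  Cardinal.toENat (Module.rank ℂ f.ker)

/-- The dimension of the cokernel, as a natural number or `∞`. -/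
noncomputable def cokernelDim (f : V →ₗ[ℂ] W) : ℕ∞ :=
  Cardinal.toENat (Module.rank ℂ (W ⧸ f.range))

theorem toENat_rank_ne_top_iff : Cardinal.toENat (Module.rank ℂ V) ≠ ⊤ ↔ FiniteDimensional ℂ V := by
  rw [Ne, Cardinal.toENat_eq_top, not_le]
  exact Module.rank_lt_aleph0_iff

theorem kernelDim_ne_top_iff {f : V →ₗ[ℂ] W} : kernelDim f ≠ ⊤ ↔ FiniteDimensional ℂ f.ker :=
  toENat_rank_ne_top_iff

theorem cokernelDim_ne_top_iff {f : V →ₗ[ℂ] W} :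
    cokernelDim f ≠ ⊤ ↔ FiniteDimensional ℂ (W ⧸ f.range) :=
  toENat_rank_ne_top_iff

theorem kernelDim_eq_zero_iff {f : V →ₗ[ℂ] W} : kernelDim f = 0 ↔ Function.Injective f := by
  rw [kernelDim, Cardinal.toENat_eq_zero, rank_zero_iff, Submodule.subsingleton_iff_eq_bot,
    LinearMap.ker_eq_bot]

theorem cokernelDim_eq_zero_iff {f : V →ₗ[ℂ] W} : cokernelDim f = 0 ↔ Function.Surjective f := by
  rw [cokernelDim, Cardinal.toENat_eq_zero, rank_zero_iff, Submodule.Quotient.subsingleton_iff,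
    LinearMap.range_eq_top]

/-- Additivity of the index under composition, arranged without subtraction so that infinite values
are allowed. It is the dimension count in the exact sequence `0 → ker j → ker fj → ker f → coker j →
coker fj → coker f → 0`; below, `h` is the connecting map and `q` the map after it. -/
theorem kernelDim_comp_add (j : U →ₗ[ℂ] V) (f : V →ₗ[ℂ] W) :
    kernelDim (f ∘ₗ j) + cokernelDim j + cokernelDim f =
      kernelDim f + kernelDim j + cokernelDim (f ∘ₗ j) := by
  have h1 : Module.rank ℂ (f ∘ₗ j).ker =
      Module.rank ℂ (f.ker ⊓ j.range : Submodule ℂ V) + Module.rank ℂ j.ker := by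
    have hle : j.ker ≤ (f ∘ₗ j).ker := LinearMap.ker_le_ker_comp j f
    have := LinearMap.rank_range_add_rank_ker (j.domRestrict (f ∘ₗ j).ker)
    rw [← this]
    congr 1
    · have : (j.domRestrict (f ∘ₗ j).ker).range = f.ker ⊓ j.range := by
        ext x
        simp only [LinearMap.mem_range, Submodule.mem_inf, LinearMap.mem_ker]
        constructor
        · rintro ⟨⟨y, hy⟩, rfl⟩
          exact ⟨hy, y, rfl⟩
        · rintro ⟨h, y, rfl⟩
          exact ⟨⟨y, h⟩, rfl⟩
      rw [this]
    · rw [LinearMap.ker_domRestrict]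
      exact (Submodule.comapSubtypeEquivOfLe hle).rank_eq
  let h := j.range.mkQ ∘ₗ f.ker.subtype
  have h2 : Module.rank ℂ f.ker =
      Module.rank ℂ h.range + Module.rank ℂ (f.ker ⊓ j.range : Submodule ℂ V) := by
    rw [← LinearMap.rank_range_add_rank_ker h]
    congr 1
    have : h.ker = j.range.comap f.ker.subtype := by
      simp [h, LinearMap.ker_comp]
    have hc : j.range.comap f.ker.subtype = (f.ker ⊓ j.range).comap f.ker.subtype := by
      rw [Submodule.comap_inf, Submodule.comap_subtype_self, top_inf_eq]
    rw [this, hc]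
    exact (Submodule.comapSubtypeEquivOfLe (p := f.ker ⊓ j.range) inf_le_left).rank_eq
  let q : (V ⧸ j.range) →ₗ[ℂ] (W ⧸ (f ∘ₗ j).range) :=
    j.range.mapQ (f ∘ₗ j).range f (by
      rintro _ ⟨y, rfl⟩
      exact ⟨y, rfl⟩)
  have hqh : q.ker = h.range := by
    ext x
    obtain ⟨x, rfl⟩ := Submodule.mkQ_surjective _ x
    simp only [q, h, LinearMap.mem_ker, Submodule.mkQ_apply, Submodule.mapQ_apply,
      Submodule.Quotient.mk_eq_zero, LinearMap.mem_range, LinearMap.comp_apply,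
      Submodule.subtype_apply, Submodule.Quotient.eq]
    constructor
    · rintro ⟨y, hy⟩
      refine ⟨⟨x - j y, by simp [hy]⟩, -y, by simp⟩
    · rintro ⟨⟨z, hz⟩, y, hy⟩
      refine ⟨-y, ?_⟩
      rw [map_neg, hy]
      simp [LinearMap.mem_ker.mp hz]
  have h3 : Module.rank ℂ (V ⧸ j.range) = Module.rank ℂ q.range + Module.rank ℂ h.range := by
    rw [← hqh, LinearMap.rank_range_add_rank_ker]
  have h4 : Module.rank ℂ (W ⧸ (f ∘ₗ j).range) =
      Module.rank ℂ (W ⧸ f.range) + Module.rank ℂ q.range := by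
    rw [← Submodule.rank_quotient_add_rank q.range]
    congr 1
    have hle : (f ∘ₗ j).range ≤ f.range := LinearMap.range_comp_le_range j f
    have : q.range = f.range.map (f ∘ₗ j).range.mkQ := by
      simp [q, Submodule.range_mapQ]
    rw [this]
    exact (Submodule.quotientQuotientEquivQuotient _ _ hle).rank_eq
  simp only [kernelDim, cokernelDim, h1, h2, h3, h4, map_add]
  ring

/-- With one factor fixed and the other varying, this shows that the dimension attached to the
varying factor stays constant as long as the composite is bijective. -/
theorem kernelDim_eq_of_bijective_comp {j : U →ₗ[ℂ] V} {f : V →ₗ[ℂ] W}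
    (h : Function.Bijective (f ∘ₗ j)) : kernelDim f = cokernelDim j := by
  have key := kernelDim_comp_add j f
  rw [LinearMap.coe_comp] at h
  rw [(kernelDim_eq_zero_iff (f := f ∘ₗ j)).mpr h.1, (cokernelDim_eq_zero_iff (f := f ∘ₗ j)).mpr h.2,
    (kernelDim_eq_zero_iff (f := j)).mpr h.1.of_comp,
    (cokernelDim_eq_zero_iff (f := f)).mpr h.2.of_comp] at key
  simpa using key.symm

/-- If `G` maps an invariant subspace `P` in such a way that `G` is bijective modulo `P`, then `G`
and its restriction to `P` have the same nullity and the same deficiency. -/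
theorem kernelDim_cokernelDim_restrict {G : V →ₗ[ℂ] V} {P : Submodule ℂ V} {H : P →ₗ[ℂ] P}
    (hH : ∀ x : P, (H x : V) = G x) (hinj : ∀ w, G w ∈ P → w ∈ P) (hsurj : ∀ x, ∃ w, x - G w ∈ P) :
    kernelDim H = kernelDim G ∧ cokernelDim H = cokernelDim G := by
  constructor
  · let e : H.ker →ₗ[ℂ] G.ker := LinearMap.restrict P.subtype (by
      intro x hx
      simp only [LinearMap.mem_ker] at hx ⊢
      simp [← hH, hx])
    have he : Function.Bijective e := by
      constructor
      · intro x y hxy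
        have := congrArg Subtype.val hxy
        exact Subtype.ext (Subtype.ext this)
      · rintro ⟨x, hx⟩
        have hxP : x ∈ P := hinj x (by rw [LinearMap.mem_ker.mp hx]; exact P.zero_mem)
        refine ⟨⟨⟨x, hxP⟩, ?_⟩, rfl⟩
        rw [LinearMap.mem_ker]
        exact Subtype.ext ((hH _).trans hx)
    rw [kernelDim, kernelDim, (LinearEquiv.ofBijective e he).rank_eq]
  · let e : (P ⧸ H.range) →ₗ[ℂ] (V ⧸ G.range) := H.range.mapQ G.range P.subtype (by
      rintro _ ⟨y, rfl⟩
      exact ⟨y, (hH y).symm⟩)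
    have he : Function.Bijective e := by
      constructor
      · rw [← LinearMap.ker_eq_bot, LinearMap.ker_eq_bot']
        intro x hx
        obtain ⟨x, rfl⟩ := Submodule.mkQ_surjective _ x
        simp only [e, Submodule.mkQ_apply, Submodule.mapQ_apply, Submodule.Quotient.mk_eq_zero,
          LinearMap.mem_range, Submodule.subtype_apply] at hx ⊢
        obtain ⟨w, hw⟩ := hx
        exact ⟨⟨w, hinj w (hw ▸ x.2)⟩, Subtype.ext ((hH _).trans hw)⟩
      · intro x
        obtain ⟨x, rfl⟩ := Submodule.mkQ_surjective _ x
        obtain ⟨w, hw⟩ := hsurj x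
        refine ⟨Submodule.Quotient.mk ⟨_, hw⟩, ?_⟩
        simp only [e, Submodule.mapQ_apply, Submodule.mkQ_apply, Submodule.subtype_apply,
          Submodule.Quotient.eq, LinearMap.mem_range]
        exact ⟨-w, by simp⟩
    rw [cokernelDim, cokernelDim, (LinearEquiv.ofBijective e he).rank_eq]

end Algebra

/-! ### Stability of surjective operators and of injective operators with closed range. -/

section Perturbation

open Filter Topology Function

theorem exists_dual_ne_zero_of_notMem {E : Type*} [NormedAddCommGroup E] [NormedSpace ℂ E]
    {R : Submodule ℂ E} (hR : IsClosed (R : Set E)) {x : E} (hx : x ∉ R) :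
    ∃ f : StrongDual ℂ E, f x ≠ 0 ∧ ∀ y ∈ R, f y = 0 := by
  have : IsClosed (R : Set E) := hR
  obtain ⟨f, hf⟩ := SeparatingDual.exists_ne_zero (R := ℂ) (x := R.mkQL x)
    (by simpa using hx)
  refine ⟨f ∘L R.mkQL, hf, fun y hy => ?_⟩
  have : R.mkQL y = 0 := by simpa using hy
  simp [this]

/-- By Riesz's lemma an infinite-dimensional `V` contains a 1-separated sequence of norm at most 3.
Approximants in `W` are within 3/8 and bounded, so two of them are within 1/4 of each other by
compactness; but 3/8 + 3/8 + 1/4 = 1. -/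
theorem finiteDimensional_of_near {E : Type*} [NormedAddCommGroup E] [NormedSpace ℂ E]
    {V W : Submodule ℂ E} [FiniteDimensional ℂ W]
    (h : ∀ x ∈ V, ∃ w ∈ W, ‖x - w‖ ≤ ‖x‖ / 8) : FiniteDimensional ℂ V := by
  by_contra hV
  obtain ⟨f, hf, hsep⟩ := exists_seq_norm_le_one_le_norm_sub' (c := (2 : ℂ)) (R := 3)
    (by norm_num) (by norm_num) hV
  choose w hwW hw using fun n => h (f n) (f n).2
  have hf3 : ∀ n, ‖(f n : E)‖ ≤ 3 := hf
  have hw3 : ∀ n, ‖(f n : E) - w n‖ ≤ 3 / 8 := fun n => (hw n).trans (by linarith [hf3 n])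
  let g : ℕ → W := fun n => ⟨w n, hwW n⟩
  have hg : ∀ n, g n ∈ Metric.closedBall (0 : W) 4 := fun n => by
    rw [mem_closedBall_zero_iff]
    change ‖w n‖ ≤ 4
    have := norm_sub_norm_le (w n) (f n)
    rw [norm_sub_rev] at this
    linarith [hf3 n, hw3 n]
  have : ProperSpace W := FiniteDimensional.proper ℂ W
  obtain ⟨a, -, φ, hφ, hlim⟩ := (isCompact_closedBall (0 : W) 4).tendsto_subseq hg
  obtain ⟨N, hN⟩ := Metric.cauchySeq_iff'.mp hlim.cauchySeq (1 / 4) (by norm_num)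
  have h1 := hN (N + 1) (Nat.le_succ N)
  have h2 : (1 : ℝ) ≤ ‖(f (φ (N + 1)) : E) - f (φ N)‖ :=
    hsep (hφ.injective.ne (Nat.succ_ne_self N))
  rw [dist_eq_norm] at h1
  change ‖w (φ (N + 1)) - w (φ N)‖ < 1 / 4 at h1
  have h3 : (f (φ (N + 1)) : E) - f (φ N) =
      (f (φ (N + 1)) - w (φ (N + 1))) - (f (φ N) - w (φ N)) + (w (φ (N + 1)) - w (φ N)) := by abel
  have h4 := norm_add_le ((f (φ (N + 1)) - w (φ (N + 1))) - (f (φ N) - w (φ N)))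
    (w (φ (N + 1)) - w (φ N))
  rw [← h3] at h4
  have h5 := norm_sub_le ((f (φ (N + 1)) : E) - w (φ (N + 1))) (f (φ N) - w (φ N))
  linarith [hw3 (φ N), hw3 (φ (N + 1))]

universe u
variable {E F : Type u} [NormedAddCommGroup E] [NormedSpace ℂ E] [CompleteSpace E]
  [NormedAddCommGroup F] [NormedSpace ℂ F] [CompleteSpace F]

/-- The open mapping theorem with a constant that is uniform near `B`. -/
theorem exists_eventually_preimage_norm_le {B : E →L[ℂ] F} (hB : Surjective B) :
    ∃ C > 0, ∀ᶠ B' : E →L[ℂ] F in 𝓝 B, ∀ y, ∃ x, B' x = y ∧ ‖x‖ ≤ C * ‖y‖ := by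
  obtain ⟨R, hR⟩ := B.exists_nonlinearRightInverse_of_surjective (LinearMap.range_eq_top.mpr hB)
  set K : ℝ := (R.nnnorm : ℝ)
  have hK : 0 < K := hR
  refine ⟨2 * K, by positivity, ?_⟩
  filter_upwards [Metric.closedBall_mem_nhds B (ε := K⁻¹ / 2) (by positivity)] with B' hB' y
  have happ : ApproximatesLinearOn B' B Set.univ (R.nnnorm⁻¹ / 2) := by
    intro x _ z _
    rw [← map_sub, ← sub_apply]
    refine (ContinuousLinearMap.le_opNorm _ _).trans ?_
    rw [mem_closedBall_iff_norm] at hB'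
    push_cast
    gcongr
  -- A ball of radius `ε` covers one of radius `(K⁻¹ - K⁻¹ / 2) * ε`, which is `‖y‖` for this `ε`.
  obtain ⟨x, hx, hxy⟩ := happ.surjOn_closedBall_of_nonlinearRightInverse R (ε := 2 * K * ‖y‖)
    (b := 0) (by positivity) (Set.subset_univ _) (a := y) (by
      rw [map_zero, mem_closedBall_zero_iff]
      push_cast
      change ‖y‖ ≤ (K⁻¹ - K⁻¹ / 2) * (2 * K * ‖y‖)
      apply le_of_eq
      field_simp
      ring)
  exact ⟨x, hxy, mem_closedBall_zero_iff.mp hx⟩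

theorem eventually_bijective {A : E →L[ℂ] F} (hA : Bijective A) :
    ∀ᶠ A' : E →L[ℂ] F in 𝓝 A, Bijective A' := by
  let e := ContinuousLinearEquiv.ofBijective A (LinearMap.ker_eq_bot.mpr hA.1)
    (LinearMap.range_eq_top.mpr hA.2)
  have := ContinuousLinearEquiv.nhds e
  rw [ContinuousLinearEquiv.coe_ofBijective] at this
  filter_upwards [this]
  rintro _ ⟨e', rfl⟩
  exact e'.bijective

/-- Near a surjective operator, all operators are surjective with kernels of the same dimension. -/
theorem eventually_surjective_kernelDim_eq {B : E →L[ℂ] F} (hB : Surjective B) :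
    ∀ᶠ B' : E →L[ℂ] F in 𝓝 B, Surjective B' ∧ kernelDim (B' : E →ₗ[ℂ] F) = kernelDim (B : E →ₗ[ℂ] F) := by
  obtain ⟨C, hC, hpre⟩ := exists_eventually_preimage_norm_le hB
  -- For a finite-dimensional kernel with closed complement `L`, the restriction of `B` to `L` is
  -- invertible. This persists nearby and forces the kernel dimension to be the codimension of `L`.
  by_cases hfin : FiniteDimensional ℂ B.ker
  · obtain ⟨L, hL, hc⟩ :=
      (Submodule.ClosedComplemented.of_finiteDimensional B.ker).exists_isClosed_isCompl
    have : CompleteSpace L := hL.completeSpace_coe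
    have key : ∀ B' : E →L[ℂ] F, Bijective (B' ∘L L.subtypeL) →
        kernelDim (B' : E →ₗ[ℂ] F) = cokernelDim L.subtype := fun B' hB' =>
      kernelDim_eq_of_bijective_comp (f := (B' : E →ₗ[ℂ] F)) hB'
    have hbij : Bijective (B ∘L L.subtypeL) := by
      constructor
      · rw [injective_iff_map_eq_zero]
        intro x hx
        have : (x : E) ∈ B.ker ⊓ L := ⟨hx, x.2⟩
        rw [hc.inf_eq_bot] at this
        exact Subtype.ext this
      · intro y
        obtain ⟨x, rfl⟩ := hB y
        obtain ⟨k, hk, l, hl, rfl⟩ := Submodule.mem_sup.mp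
          (hc.sup_eq_top ▸ Submodule.mem_top : x ∈ B.ker ⊔ L)
        refine ⟨⟨l, hl⟩, ?_⟩
        have : B k = 0 := hk
        simp [this]
    have hcont : Continuous fun B' : E →L[ℂ] F => B' ∘L L.subtypeL :=
      continuous_id.clm_comp continuous_const
    filter_upwards [hcont.continuousAt.eventually (eventually_bijective hbij)] with B' hB'
    exact ⟨Surjective.of_comp (g := L.subtype) hB'.2, (key B' hB').trans (key B hbij).symm⟩
  -- For `x` in `ker B`, a small preimage of `B' x` under `B'` corrects `x` to an element of `ker
  -- B'` at distance at most `‖x‖ / 8`. So `ker B'` cannot be finite-dimensional.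
  · filter_upwards [hpre, Metric.closedBall_mem_nhds B (ε := (8 * C)⁻¹) (by positivity)]
      with B' hB' hnear
    refine ⟨fun y => (hB' y).imp fun x hx => hx.1, ?_⟩
    rw [not_ne_iff.mp (kernelDim_ne_top_iff.not.mpr hfin)]
    by_contra hne
    have := kernelDim_ne_top_iff.mp hne
    refine hfin (finiteDimensional_of_near (W := B'.ker) fun x hx => ?_)
    obtain ⟨z, hz, hzn⟩ := hB' (B' x)
    refine ⟨x - z, by simp [LinearMap.mem_ker, hz], ?_⟩
    have hx0 : B x = 0 := hx
    have h1 : ‖B' x‖ ≤ (8 * C)⁻¹ * ‖x‖ := by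
      rw [show B' x = (B' - B) x by simp [hx0]]
      refine (ContinuousLinearMap.le_opNorm _ _).trans ?_
      gcongr
      exact mem_closedBall_iff_norm.mp hnear
    rw [sub_sub_cancel]
    calc ‖z‖ ≤ C * ‖B' x‖ := hzn
      _ ≤ C * ((8 * C)⁻¹ * ‖x‖) := by gcongr
      _ = ‖x‖ / 8 := by field_simp

/-- The functionals that vanish on the range of an operator. -/
def rangeAnnihilator (A : E →L[ℂ] F) : Submodule ℂ (StrongDual ℂ F) where
  carrier := {f | ∀ x, f (A x) = 0}
  add_mem' hf hg x := by simp [hf x, hg x]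
  zero_mem' := by simp
  smul_mem' c f hf x := by simp [hf x]

omit [CompleteSpace E] [CompleteSpace F] in
theorem finiteDimensional_rangeAnnihilator (A : E →L[ℂ] F) [FiniteDimensional ℂ (F ⧸ A.range)] :
    FiniteDimensional ℂ (rangeAnnihilator A) := by
  have := A.range.dualQuotEquivDualAnnihilator.finiteDimensional
  let g : rangeAnnihilator A →ₗ[ℂ] A.range.dualAnnihilator :=
    ((ContinuousLinearMap.coeLM ℂ).domRestrict (rangeAnnihilator A)).codRestrict _ (by
      rintro ⟨f, hf⟩
      rw [Submodule.mem_dualAnnihilator]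
      rintro _ ⟨x, rfl⟩
      exact hf x)
  refine FiniteDimensional.of_injective g fun f f' h => ?_
  exact Subtype.ext (ContinuousLinearMap.coe_injective (congrArg Subtype.val h))

-- By Hahn–Banach, a closed range is recovered as the common kernel of the functionals vanishing on
-- it.
omit [CompleteSpace E] [CompleteSpace F] in
theorem finiteDimensional_quotient_range (A : E →L[ℂ] F) (hA : IsClosed (A.range : Set F))
    [FiniteDimensional ℂ (rangeAnnihilator A)] : FiniteDimensional ℂ (F ⧸ A.range) := by
  let W : Submodule ℂ (Module.Dual ℂ F) := (rangeAnnihilator A).map (ContinuousLinearMap.coeLM ℂ)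
  have hW : W.dualCoannihilator = A.range := by
    ext x
    rw [Submodule.mem_dualCoannihilator]
    constructor
    · intro hx
      by_contra hxA
      obtain ⟨f, hfx, hf⟩ := exists_dual_ne_zero_of_notMem hA hxA
      exact hfx (hx f ⟨f, fun y => hf _ ⟨y, rfl⟩, rfl⟩)
    · rintro ⟨y, rfl⟩ _ ⟨f, hf, rfl⟩
      exact hf y
  rw [← hW]
  exact Subspace.finiteDimensional_quot_dualCoannihilator_iff.mpr (Module.Finite.map _ _)

/-- Near an injective operator with closed range, all operators are injective with ranges of the
same codimension. -/
theorem eventually_injective_cokernelDim_eq {A : E →L[ℂ] F} (hA : Injective A)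
    (hcl : IsClosed (A.range : Set F)) :
    ∀ᶠ A' : E →L[ℂ] F in 𝓝 A, Injective A' ∧
      cokernelDim (A' : E →ₗ[ℂ] F) = cokernelDim (A : E →ₗ[ℂ] F) := by
  by_cases hfin : FiniteDimensional ℂ (F ⧸ A.range)
  · obtain ⟨G, hG⟩ := A.range.exists_isCompl
    have : CompleteSpace A.range := hcl.completeSpace_coe
    let P := A.range.projectionOntoL G
      (Submodule.IsCompl.isTopCompl_of_finiteDimensional_quotient hG hcl)
    have hP : ∀ x, P (A x) = ⟨A x, x, rfl⟩ := fun x =>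
      Submodule.projectionOnto_apply_left hG ⟨A x, x, rfl⟩
    have key : ∀ A' : E →L[ℂ] F, Bijective (P ∘L A') →
        cokernelDim (A' : E →ₗ[ℂ] F) = kernelDim (P : F →ₗ[ℂ] A.range) := fun A' hA' =>
      (kernelDim_eq_of_bijective_comp (j := (A' : E →ₗ[ℂ] F)) hA').symm
    have hbij : Bijective (P ∘L A) := by
      constructor
      · intro x y hxy
        have : P (A x) = P (A y) := hxy
        rw [hP, hP] at this
        exact hA (congrArg Subtype.val this)
      · rintro ⟨_, x, rfl⟩
        exact ⟨x, hP x⟩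
    have hcont : Continuous fun A' : E →L[ℂ] F => P ∘L A' :=
      continuous_const.clm_comp continuous_id
    filter_upwards [hcont.continuousAt.eventually (eventually_bijective hbij)] with A' hA'
    exact ⟨Injective.of_comp (f := P) hA'.1, (key A' hA').trans (key A hbij).symm⟩
  -- In infinite codimension the argument passes to annihilators. A functional killing `R(A)` is
  -- small on `R(A')`; subtracting a Hahn–Banach extension of that restriction gives a nearby
  -- functional killing `R(A')`.
  · obtain ⟨K₀, hK₀⟩ := A.antilipschitz_of_injective_of_isClosed_range hA hcl
    set K : ℝ := K₀ + 1
    have hK : 0 < K := by positivity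
    have hbound : ∀ x, ‖x‖ ≤ K * ‖A x‖ := fun x => by
      have := hK₀.le_mul_dist x 0
      rw [map_zero, dist_zero_right, dist_zero_right] at this
      exact this.trans (by gcongr; simp [K])
    -- The operators `A'` in this ball are bounded below with constant `2 * K`, and `(16 * K)⁻¹ * (2
    -- * K) = 1 / 8` is the ratio that `finiteDimensional_of_near` requires.
    filter_upwards [Metric.closedBall_mem_nhds A (ε := (16 * K)⁻¹) (by positivity)]
      with A' hnear
    have hdiff : ∀ x, ‖(A' - A) x‖ ≤ (16 * K)⁻¹ * ‖x‖ := fun x => by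
      refine (ContinuousLinearMap.le_opNorm _ _).trans ?_
      gcongr
      exact mem_closedBall_iff_norm.mp hnear
    have hbound' : ∀ x, ‖x‖ ≤ 2 * K * ‖A' x‖ := fun x => by
      have h1 : ‖A x‖ ≤ ‖A' x‖ + (16 * K)⁻¹ * ‖x‖ := by
        have : A x = A' x - (A' - A) x := by simp
        rw [this]
        exact (norm_sub_le _ _).trans (by gcongr; exact hdiff x)
      have h2 : K * ((16 * K)⁻¹ * ‖x‖) = ‖x‖ / 16 := by field_simp
      have h3 : K * ‖A x‖ ≤ K * (‖A' x‖ + (16 * K)⁻¹ * ‖x‖) := by gcongr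
      have h4 := hbound x
      linarith [norm_nonneg x]
    refine ⟨?_, ?_⟩
    · rw [injective_iff_map_eq_zero]
      intro x hx
      have := hbound' x
      rw [hx, norm_zero, mul_zero] at this
      exact norm_le_zero_iff.mp this
    rw [not_ne_iff.mp (cokernelDim_ne_top_iff.not.mpr hfin)]
    by_contra hne
    have := cokernelDim_ne_top_iff.mp hne
    have := finiteDimensional_rangeAnnihilator A'
    have : FiniteDimensional ℂ (rangeAnnihilator A) := by
      refine finiteDimensional_of_near (W := rangeAnnihilator A') fun f hf => ?_
      let f₁ : StrongDual ℂ A'.range := f ∘L A'.range.subtypeL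
      obtain ⟨g, hg, hgn⟩ := exists_extension_norm_eq A'.range f₁
      refine ⟨f - g, fun x => ?_, ?_⟩
      · have : g (A' x) = f (A' x) := hg ⟨A' x, x, rfl⟩
        simp [this]
      · rw [sub_sub_cancel, hgn]
        refine ContinuousLinearMap.opNorm_le_bound _ (by positivity) ?_
        rintro ⟨_, x, rfl⟩
        change ‖f (A' x)‖ ≤ ‖f‖ / 8 * ‖A' x‖
        have h1 : f (A' x) = f ((A' - A) x) := by
          have : f (A x) = 0 := hf x
          simp [this]
        rw [h1]
        calc ‖f ((A' - A) x)‖ ≤ ‖f‖ * ‖(A' - A) x‖ := f.le_opNorm _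
          _ ≤ ‖f‖ * ((16 * K)⁻¹ * (2 * K * ‖A' x‖)) := by
            gcongr
            exact (hdiff x).trans (by gcongr; exact hbound' x)
          _ = ‖f‖ / 8 * ‖A' x‖ := by
            field_simp
            ring
    exact hfin (finiteDimensional_quotient_range A hcl)

end Perturbation

/-! ### Stability of the index, and closed ranges of powers. -/

section Index

open Filter Topology Function

/-- Returns from subtraction-free identities to indices. The finiteness hypothesis rules out `∞ -
∞`, and `h` then makes the other two terms infinite simultaneously. -/
theorem enat_sub_eq_sub {a b c d : ℕ∞} (h : a + d = c + b)
    (hfin : (b ≠ ⊤ ∧ d ≠ ⊤) ∨ (a ≠ ⊤ ∧ c ≠ ⊤)) :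
    ((a : ENNReal) : EReal) - ((b : ENNReal) : EReal) =
      ((c : ENNReal) : EReal) - ((d : ENNReal) : EReal) := by
  have hnat : ∀ n : ℕ, (((n : ℕ∞) : ENNReal) : EReal) = ((n : ℝ) : EReal) := fun n => by
    rw [ENat.toENNReal_coe]
    rfl
  have hnn : ∀ a b c d : ℕ, (a : ℕ∞) + d = c + b →
      (((a : ℕ∞) : ENNReal) : EReal) - (((b : ℕ∞) : ENNReal) : EReal) =
      (((c : ℕ∞) : ENNReal) : EReal) - (((d : ℕ∞) : ENNReal) : EReal) := by
    intro a b c d h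
    have h' : a + d = c + b := by exact_mod_cast h
    have h'' : (a : ℝ) + d = c + b := by exact_mod_cast h'
    rw [hnat, hnat, hnat, hnat, ← EReal.coe_sub, ← EReal.coe_sub, EReal.coe_eq_coe_iff]
    linarith
  rcases hfin with ⟨hb, hd⟩ | ⟨ha, hc⟩
  · lift b to ℕ using hb
    lift d to ℕ using hd
    induction a using ENat.recTopCoe with
    | top =>
      induction c using ENat.recTopCoe with
      | top => rw [hnat, hnat, ENat.toENNReal_top, EReal.coe_ennreal_top, EReal.top_sub_coe,
          EReal.top_sub_coe]
      | coe c => exact absurd h (by rw [top_add]; exact (ENat.natCast_ne_top (c + b)).symm)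
    | coe a =>
      induction c using ENat.recTopCoe with
      | top => exact absurd h (by rw [top_add]; exact ENat.natCast_ne_top (a + d))
      | coe c => exact hnn a b c d h
  · lift a to ℕ using ha
    lift c to ℕ using hc
    induction b using ENat.recTopCoe with
    | top =>
      induction d using ENat.recTopCoe with
      | top => rw [hnat, hnat]; simp
      | coe d => exact absurd h (by rw [add_top]; exact ENat.natCast_ne_top (a + d))
    | coe b =>
      induction d using ENat.recTopCoe with
      | top => exact absurd h (by rw [add_top]; exact (ENat.natCast_ne_top (c + b)).symm)
      | coe d => exact hnn a b c d h

universe u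
variable {E : Type u} [NormedAddCommGroup E] [NormedSpace ℂ E] [CompleteSpace E]

/-- On a closed complement `L` of the kernel, `S` is injective with closed range, so nearby
operators restricted to `L` have the same deficiency. Composition with the inclusion of `L`, of
finite codimension, shifts all the indices by the same finite amount. -/
theorem IsUpperSemiFredholm.eventually_index_eq {S : E →L[ℂ] E} (hS : IsUpperSemiFredholm S) :
    ∀ᶠ S' in 𝓝 S, index S' = index S := by
  obtain ⟨hcl, hfin⟩ := hS
  obtain ⟨L, hL, hc⟩ :=
    (Submodule.ClosedComplemented.of_finiteDimensional S.ker).exists_isClosed_isCompl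
  have : CompleteSpace L := hL.completeSpace_coe
  have hinj : Injective (S ∘L L.subtypeL) := by
    rw [injective_iff_map_eq_zero]
    intro x hx
    have : (x : E) ∈ S.ker ⊓ L := ⟨hx, x.2⟩
    rw [hc.inf_eq_bot] at this
    exact Subtype.ext this
  have hrange : (S ∘L L.subtypeL).range = S.range := by
    ext y
    constructor
    · rintro ⟨x, rfl⟩
      exact ⟨x, rfl⟩
    · rintro ⟨x, rfl⟩
      obtain ⟨k, hk, l, hl, rfl⟩ := Submodule.mem_sup.mp
        (hc.sup_eq_top ▸ Submodule.mem_top : x ∈ S.ker ⊔ L)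
      have hk0 : S k = 0 := hk
      exact ⟨⟨l, hl⟩, by simp [hk0]⟩
  have hcont : Continuous fun S' : E →L[ℂ] E => S' ∘L L.subtypeL :=
    continuous_id.clm_comp continuous_const
  have hquot : FiniteDimensional ℂ (E ⧸ L) :=
    (Submodule.quotientEquivOfIsCompl L S.ker hc.symm).symm.finiteDimensional
  have hδ : cokernelDim L.subtype ≠ ⊤ := by
    rw [cokernelDim_ne_top_iff, Submodule.range_subtype]
    exact hquot
  have key : ∀ S' : E →L[ℂ] E, Injective (S' ∘L L.subtypeL) →
      cokernelDim L.subtype + deficiency S' =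
        nullity S' + cokernelDim ((S' ∘L L.subtypeL : L →L[ℂ] E) : L →ₗ[ℂ] E) := by
    intro S' hS'
    have h := kernelDim_comp_add L.subtype (S' : E →ₗ[ℂ] E)
    rw [(kernelDim_eq_zero_iff (f := (S' : E →ₗ[ℂ] E) ∘ₗ L.subtype)).mpr hS',
      kernelDim_eq_zero_iff.mpr L.subtype_injective, zero_add, add_zero] at h
    exact h
  have hνfin : ∀ S' : E →L[ℂ] E, Injective (S' ∘L L.subtypeL) → nullity S' ≠ ⊤ := by
    intro S' hS'
    refine (kernelDim_ne_top_iff (f := (S' : E →ₗ[ℂ] E))).mpr ?_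
    refine FiniteDimensional.of_injective (L.mkQ ∘ₗ S'.ker.subtype) ?_
    rw [← LinearMap.ker_eq_bot, LinearMap.ker_eq_bot']
    rintro ⟨x, hx⟩ hxL
    have hxL' : x ∈ L := by simpa using hxL
    have := (injective_iff_map_eq_zero _).mp hS' ⟨x, hxL'⟩ hx
    exact Subtype.ext (congrArg (fun z : L => (z : E)) this)
  filter_upwards [hcont.continuousAt.eventually
    (eventually_injective_cokernelDim_eq hinj (hrange ▸ hcl))] with S' hS'
  refine enat_sub_eq_sub ?_ (Or.inr ⟨hνfin S' hS'.1, hνfin S hinj⟩)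
  refine (ENat.addLECancellable_of_ne_top hδ).inj.mp ?_
  have h1 := key S' hS'.1
  rw [hS'.2] at h1
  calc _ = nullity S' + (cokernelDim L.subtype + deficiency S) := by ring
    _ = nullity S + (cokernelDim L.subtype + deficiency S') := by rw [key S hinj, h1]; ring
    _ = _ := by ring

/-- Dual device: a finite-dimensional complement `G` of the range is added to the domain, which
makes the operator surjective with locally constant kernel dimension. -/
theorem IsLowerSemiFredholm.eventually_index_eq {S : E →L[ℂ] E} (hS : IsLowerSemiFredholm S) :
    ∀ᶠ S' in 𝓝 S, index S' = index S := by
  have hS' : FiniteDimensional ℂ (E ⧸ S.range) := hS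
  obtain ⟨G, hG⟩ := S.range.exists_isCompl
  have hGfin : FiniteDimensional ℂ G :=
    (Submodule.quotientEquivOfIsCompl _ _ hG).finiteDimensional
  have : CompleteSpace G := FiniteDimensional.complete ℂ G
  have hsurj : Surjective (S.coprod G.subtypeL) := by
    intro x
    obtain ⟨_, ⟨y, rfl⟩, g, hg, rfl⟩ := Submodule.mem_sup.mp
      (hG.sup_eq_top ▸ Submodule.mem_top : x ∈ S.range ⊔ G)
    exact ⟨(y, ⟨g, hg⟩), rfl⟩
  have hcont : Continuous fun S' : E →L[ℂ] E => S'.coprod G.subtypeL := by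
    have : (fun S' : E →L[ℂ] E => S'.coprod G.subtypeL) =
        fun S' => S' ∘L ContinuousLinearMap.fst ℂ E G + G.subtypeL ∘L
          ContinuousLinearMap.snd ℂ E G := by
      ext S' x <;> simp
    rw [this]
    exact (continuous_id.clm_comp continuous_const).add continuous_const
  have hδ : cokernelDim (LinearMap.inl ℂ E G) ≠ ⊤ := by
    rw [cokernelDim_ne_top_iff, LinearMap.range_inl]
    exact (LinearMap.quotKerEquivRange _).symm.finiteDimensional
  have key : ∀ S' : E →L[ℂ] E, Surjective (S'.coprod G.subtypeL) →
      nullity S' + cokernelDim (LinearMap.inl ℂ E G) =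
        kernelDim ((S'.coprod G.subtypeL : E × G →L[ℂ] E) : E × G →ₗ[ℂ] E) + deficiency S' := by
    intro S' hS'
    have h := kernelDim_comp_add (LinearMap.inl ℂ E G)
      ((S'.coprod G.subtypeL : E × G →L[ℂ] E) : E × G →ₗ[ℂ] E)
    have hcomp : ((S'.coprod G.subtypeL : E × G →L[ℂ] E) : E × G →ₗ[ℂ] E) ∘ₗ
        LinearMap.inl ℂ E G = S' := by
      ext x
      simp
    rw [hcomp, cokernelDim_eq_zero_iff.mpr (show Surjective
        ((S'.coprod G.subtypeL : E × G →L[ℂ] E) : E × G →ₗ[ℂ] E) from hS'),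
      (kernelDim_eq_zero_iff (f := LinearMap.inl ℂ E G)).mpr LinearMap.inl_injective, add_zero, add_zero] at h
    exact h
  have hδfin : ∀ S' : E →L[ℂ] E, Surjective (S'.coprod G.subtypeL) → deficiency S' ≠ ⊤ := by
    intro S' hS'
    refine (cokernelDim_ne_top_iff (f := (S' : E →ₗ[ℂ] E))).mpr ?_
    refine Module.Finite.of_surjective (S'.range.mkQ ∘ₗ G.subtype) fun x => ?_
    obtain ⟨x, rfl⟩ := Submodule.mkQ_surjective _ x
    obtain ⟨⟨y, g⟩, rfl⟩ := hS' x
    refine ⟨g, ?_⟩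
    simp only [LinearMap.comp_apply, Submodule.mkQ_apply, Submodule.Quotient.eq]
    exact ⟨-y, by simp⟩
  filter_upwards [hcont.continuousAt.eventually (eventually_surjective_kernelDim_eq hsurj)]
    with S' hS'
  refine enat_sub_eq_sub ?_ (Or.inl ⟨hδfin S' hS'.1, hδfin S hsurj⟩)
  refine (ENat.addLECancellable_of_ne_top hδ).inj.mp ?_
  have h1 := key S' hS'.1
  rw [hS'.2] at h1
  calc _ = (nullity S' + cokernelDim (LinearMap.inl ℂ E G)) + deficiency S := by ring
    _ = (nullity S + cokernelDim (LinearMap.inl ℂ E G)) + deficiency S' := by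
      rw [key S hsurj, h1]; ring
    _ = _ := by ring

omit [CompleteSpace E] in
theorem tendsto_sub_smul_one (S : E →L[ℂ] E) :
    Tendsto (fun c : ℂ => S - c • (1 : E →L[ℂ] E)) (𝓝 0) (𝓝 S) := by
  have : Continuous fun c : ℂ => S - c • (1 : E →L[ℂ] E) := by fun_prop
  simpa using this.tendsto 0

/-- The index of a semi-Fredholm operator is stable under small perturbations. -/
theorem IsSemiFredholm.eventually_index_eq {S : E →L[ℂ] E} (hS : IsSemiFredholm S) :
    ∀ᶠ c : ℂ in 𝓝 0, index (S - c • 1) = index S :=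
  (tendsto_sub_smul_one S).eventually
    (hS.elim IsUpperSemiFredholm.eventually_index_eq IsLowerSemiFredholm.eventually_index_eq)

/-- `S` is a quotient map onto its closed range, and the preimage of `S(P)` is `P + ker S`, closed
because the kernel is finite-dimensional. -/
theorem IsUpperSemiFredholm.isClosed_map {S : E →L[ℂ] E} (hS : IsUpperSemiFredholm S)
    {P : Submodule ℂ E} (hP : IsClosed (P : Set E)) :
    IsClosed (P.map (S : E →ₗ[ℂ] E) : Set E) := by
  obtain ⟨hcl, hfin⟩ := hS
  have hsup := Submodule.isClosed_sup_finiteDimensional P S.ker hP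
  have : CompleteSpace S.range := hcl.completeSpace_coe
  have hopen : IsOpenMap (S.rangeRestrict) :=
    ContinuousLinearMap.isOpenMap _ (by rintro ⟨_, x, rfl⟩; exact ⟨x, rfl⟩)
  have hq : IsQuotientMap S.rangeRestrict := hopen.isQuotientMap S.rangeRestrict.continuous
    (by rintro ⟨_, x, rfl⟩; exact ⟨x, rfl⟩)
  have h1 : IsClosed (S.rangeRestrict '' P) := by
    rw [← hq.isClosed_preimage]
    convert hsup using 1
    ext x
    simp only [Set.mem_preimage, Set.mem_image, SetLike.mem_coe, Submodule.mem_sup]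
    constructor
    · rintro ⟨p, hp, h⟩
      have h' : S p = S x := congrArg Subtype.val h
      exact ⟨p, hp, x - p, by simp [LinearMap.mem_ker, h'], by abel⟩
    · rintro ⟨p, hp, k, hk, rfl⟩
      have hk0 : S k = 0 := hk
      exact ⟨p, hp, Subtype.ext (by simp [hk0])⟩
  convert hcl.isClosedEmbedding_subtypeVal.isClosedMap _ h1 using 1
  ext x
  constructor
  · rintro ⟨p, hp, rfl⟩
    exact ⟨_, ⟨p, hp, rfl⟩, rfl⟩
  · rintro ⟨_, ⟨p, hp, rfl⟩, rfl⟩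
    exact ⟨p, hp, rfl⟩

/-- The complement of the range is the image of the open set `E × (G \ {0})` under the open
surjection `(x, g) ↦ S x + g`. -/
theorem IsLowerSemiFredholm.isClosed_range {S : E →L[ℂ] E} (hS : IsLowerSemiFredholm S) :
    IsClosed (S.range : Set E) := by
  have hS' : FiniteDimensional ℂ (E ⧸ S.range) := hS
  obtain ⟨G, hG⟩ := S.range.exists_isCompl
  have hGfin : FiniteDimensional ℂ G :=
    (Submodule.quotientEquivOfIsCompl _ _ hG).finiteDimensional
  have : CompleteSpace G := FiniteDimensional.complete ℂ G
  have hsurj : Surjective (S.coprod G.subtypeL) := by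
    intro x
    obtain ⟨_, ⟨y, rfl⟩, g, hg, rfl⟩ := Submodule.mem_sup.mp
      (hG.sup_eq_top ▸ Submodule.mem_top : x ∈ S.range ⊔ G)
    exact ⟨(y, ⟨g, hg⟩), rfl⟩
  have hopen := (S.coprod G.subtypeL).isOpenMap hsurj (Set.univ ×ˢ {0}ᶜ)
    (isOpen_univ.prod isOpen_compl_singleton)
  rw [← isOpen_compl_iff]
  convert hopen using 1
  ext x
  simp only [Set.mem_compl_iff, SetLike.mem_coe, Set.mem_image, Set.mem_prod, Set.mem_univ,
    true_and, Set.mem_singleton_iff, Prod.exists]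
  constructor
  · intro hx
    obtain ⟨⟨y, g⟩, rfl⟩ := hsurj x
    refine ⟨y, g, ?_, rfl⟩
    rintro rfl
    exact hx ⟨y, by simp⟩
  · rintro ⟨y, g, hg, rfl⟩ ⟨z, hz⟩
    have h1 : (g : E) = S (z - y) := by
      rw [map_sub]
      have : S z = S y + g := hz
      rw [this]
      abel
    have : (g : E) ∈ S.range ⊓ G := ⟨⟨_, h1.symm⟩, g.2⟩
    rw [hG.inf_eq_bot] at this
    exact hg (Subtype.ext this)

theorem IsUpperSemiFredholm.isClosed_range_pow {S : E →L[ℂ] E} (hS : IsUpperSemiFredholm S)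
    (n : ℕ) : IsClosed ((S ^ n).range : Set E) := by
  induction n with
  | zero =>
    have : ((S ^ 0).range : Set E) = Set.univ := by
      ext x
      simp
    rw [this]
    exact isClosed_univ
  | succ n ih =>
    convert hS.isClosed_map ih using 1
    ext x
    simp [pow_succ']

theorem finiteDimensional_quotient_of_sup_eq_top {V : Type*} [AddCommGroup V] [Module ℂ V]
    {P G : Submodule ℂ V} [FiniteDimensional ℂ G] (h : ∀ x, ∃ g ∈ G, x - g ∈ P) :
    FiniteDimensional ℂ (V ⧸ P) := by
  refine Module.Finite.of_surjective (P.mkQ ∘ₗ G.subtype) fun x => ?_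
  obtain ⟨x, rfl⟩ := Submodule.mkQ_surjective _ x
  obtain ⟨g, hg, hx⟩ := h x
  refine ⟨⟨g, hg⟩, ?_⟩
  simp only [LinearMap.comp_apply, Submodule.mkQ_apply, Submodule.Quotient.eq,
    Submodule.subtype_apply]
  rw [← neg_sub]
  exact P.neg_mem hx

omit [CompleteSpace E] in
theorem IsLowerSemiFredholm.pow {S : E →L[ℂ] E} (hS : IsLowerSemiFredholm S)
    (n : ℕ) : IsLowerSemiFredholm (S ^ n) := by
  induction n with
  | zero =>
    exact (cokernelDim_ne_top_iff (f := ((S ^ 0 : E →L[ℂ] E) : E →ₗ[ℂ] E))).mp (by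
      rw [cokernelDim_eq_zero_iff.mpr]
      · simp
      · exact fun x => ⟨x, rfl⟩)
  | succ n ih =>
    have hS' : FiniteDimensional ℂ (E ⧸ S.range) := hS
    have ih' : FiniteDimensional ℂ (E ⧸ (S ^ n).range) := ih
    obtain ⟨G, hG⟩ := S.range.exists_isCompl
    have hGfin : FiniteDimensional ℂ G :=
      (Submodule.quotientEquivOfIsCompl _ _ hG).finiteDimensional
    obtain ⟨H, hH⟩ := (S ^ n).range.exists_isCompl
    have hHfin : FiniteDimensional ℂ H :=
      (Submodule.quotientEquivOfIsCompl _ _ hH).finiteDimensional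
    refine finiteDimensional_quotient_of_sup_eq_top (G := G ⊔ H.map (S : E →ₗ[ℂ] E)) fun x => ?_
    obtain ⟨_, ⟨y, rfl⟩, g, hg, rfl⟩ := Submodule.mem_sup.mp
      (hG.sup_eq_top ▸ Submodule.mem_top : x ∈ S.range ⊔ G)
    obtain ⟨_, ⟨z, rfl⟩, k, hk, rfl⟩ := Submodule.mem_sup.mp
      (hH.sup_eq_top ▸ Submodule.mem_top : y ∈ (S ^ n).range ⊔ H)
    refine ⟨g + S k, Submodule.add_mem_sup hg ⟨k, hk, rfl⟩, z, ?_⟩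
    change (S ^ (n + 1)) z = S ((S ^ n) z + k) + g - (g + S k)
    rw [pow_succ', map_add]
    change S ((S ^ n) z) = _
    abel

theorem IsSemiFredholm.isClosed_range_pow {S : E →L[ℂ] E} (hS : IsSemiFredholm S)
    (n : ℕ) : IsClosed ((S ^ n).range : Set E) :=
  hS.elim (fun h => h.isClosed_range_pow n) (fun h => (h.pow n).isClosed_range)

end Index

/-! ### Restrictions, reducing pairs and splitting off a Jordan chain. -/

section Kato

open Filter Topology Function

universe u
variable {E : Type u} [NormedAddCommGroup E] [NormedSpace ℂ E]

theorem pow_succ_apply (S : E →L[ℂ] E) (n : ℕ) (x : E) : (S ^ (n + 1)) x = S ((S ^ n) x) := by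
  rw [pow_succ']
  rfl

theorem pow_succ_apply' (S : E →L[ℂ] E) (n : ℕ) (x : E) : (S ^ (n + 1)) x = (S ^ n) (S x) := by
  rw [pow_succ]
  rfl

theorem pow_add_apply (S : E →L[ℂ] E) (m n : ℕ) (x : E) :
    (S ^ (m + n)) x = (S ^ m) ((S ^ n) x) := by
  rw [pow_add]
  rfl

theorem pow_mem_of_mapsTo {S : E →L[ℂ] E} {P : Submodule ℂ E} (h : ∀ x ∈ P, S x ∈ P) (n : ℕ)
    {x : E} (hx : x ∈ P) : (S ^ n) x ∈ P := by
  induction n with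
  | zero => simpa using hx
  | succ n ih =>
    rw [pow_succ_apply]
    exact h _ ih

theorem coe_restrict_pow {S : E →L[ℂ] E} {P : Submodule ℂ E} (h : ∀ x ∈ P, S x ∈ P) (n : ℕ)
    (x : P) : (((S.restrict h) ^ n) x : E) = (S ^ n) x := by
  induction n with
  | zero => simp
  | succ n ih =>
    rw [pow_succ_apply, pow_succ_apply, ← ih]
    rfl

theorem isNilpotent_restrict_iff {S : E →L[ℂ] E} {P : Submodule ℂ E} (h : ∀ x ∈ P, S x ∈ P) :
    IsNilpotent (S.restrict h) ↔ ∃ n : ℕ, ∀ x ∈ P, (S ^ n) x = 0 := by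
  refine exists_congr fun n => ?_
  constructor
  · intro hn x hx
    rw [← coe_restrict_pow h n ⟨x, hx⟩, hn]
    rfl
  · intro hn
    ext x
    rw [coe_restrict_pow, hn x x.2]
    rfl

theorem isClosed_range_restrict_iff {S : E →L[ℂ] E} {P : Submodule ℂ E}
    (hP : IsClosed (P : Set E)) (h : ∀ x ∈ P, S x ∈ P) :
    IsClosed ((S.restrict h).range : Set P) ↔ IsClosed (P.map (S : E →ₗ[ℂ] E) : Set E) := by
  rw [hP.isClosedEmbedding_subtypeVal.isClosed_iff_image_isClosed]
  have : (Subtype.val '' ((S.restrict h).range : Set P)) = (P.map (S : E →ₗ[ℂ] E) : Set E) := by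
    ext x
    constructor
    · rintro ⟨_, ⟨p, rfl⟩, rfl⟩
      exact ⟨p, p.2, rfl⟩
    · rintro ⟨p, hp, rfl⟩
      exact ⟨_, ⟨⟨p, hp⟩, rfl⟩, rfl⟩
  rw [← this]
  rfl

theorem isSemiRegular_restrict_iff {S : E →L[ℂ] E} {P : Submodule ℂ E}
    (hP : IsClosed (P : Set E)) (h : ∀ x ∈ P, S x ∈ P) :
    IsSemiRegular (S.restrict h) ↔ IsClosed (P.map (S : E →ₗ[ℂ] E) : Set E) ∧
      ∀ n : ℕ, ∀ x ∈ P, S x = 0 → ∃ y ∈ P, (S ^ n) y = x := by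
  refine and_congr (isClosed_range_restrict_iff hP h) (forall_congr' fun n => ?_)
  constructor
  · intro hn x hx hSx
    obtain ⟨y, hy⟩ := hn (show (⟨x, hx⟩ : P) ∈ (S.restrict h).ker from Subtype.ext hSx)
    refine ⟨y, y.2, ?_⟩
    rw [← coe_restrict_pow h]
    exact congrArg Subtype.val hy
  · rintro hn ⟨x, hx⟩ hSx
    obtain ⟨y, hy, hyx⟩ := hn x hx (congrArg Subtype.val hSx)
    exact ⟨⟨y, hy⟩, Subtype.ext ((coe_restrict_pow h n _).trans hyx)⟩

theorem Red.symm {S : E →L[ℂ] E} {A B : Submodule ℂ E} (h : Red S A B) : Red S B A :=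
  ⟨h.isClosed_right, h.isClosed_left, h.mapsTo_right, h.mapsTo_left, h.isCompl.symm⟩

theorem Red.exists_add {S : E →L[ℂ] E} {A B : Submodule ℂ E} (h : Red S A B) (x : E) :
    ∃ a ∈ A, ∃ b ∈ B, a + b = x :=
  Submodule.mem_sup.mp (h.isCompl.sup_eq_top ▸ Submodule.mem_top)

theorem Red.eq_zero_of_mem {S : E →L[ℂ] E} {A B : Submodule ℂ E} (h : Red S A B) {x : E}
    (hA : x ∈ A) (hB : x ∈ B) : x = 0 :=
  Submodule.disjoint_def.mp h.isCompl.disjoint x hA hB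

theorem Red.exists_ker_map {S : E →L[ℂ] E} {A B : Submodule ℂ E} (h : Red S A B) :
    ∃ j : (S.restrict h.mapsTo_left).ker →ₗ[ℂ] S.ker,
      Function.Injective j ∧ ∀ z, (j z : E) = (z : A) := by
  refine ⟨(A.subtype.domRestrict (S.restrict h.mapsTo_left).ker).codRestrict S.ker
    fun z => congrArg Subtype.val z.2, fun z w hzw => ?_, fun z => rfl⟩
  exact Subtype.ext (Subtype.ext (congrArg (fun v : S.ker => (v : E)) hzw))

theorem Red.exists_quotient_range_map {S : E →L[ℂ] E} {A B : Submodule ℂ E} (h : Red S A B) :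
    ∃ j : (A ⧸ (S.restrict h.mapsTo_left).range) →ₗ[ℂ] (E ⧸ S.range),
      Function.Injective j ∧ ∀ a : A, j (Submodule.Quotient.mk a) = Submodule.Quotient.mk (a : E) := by
  refine ⟨Submodule.mapQ _ _ A.subtype ?_, ?_, fun a => rfl⟩
  · rintro _ ⟨z, rfl⟩
    exact ⟨z, rfl⟩
  · rw [← LinearMap.ker_eq_bot, LinearMap.ker_eq_bot']
    intro z hz
    obtain ⟨z, rfl⟩ := Submodule.mkQ_surjective _ z
    simp only [Submodule.mkQ_apply, Submodule.mapQ_apply, Submodule.Quotient.mk_eq_zero,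
      Submodule.subtype_apply] at hz ⊢
    obtain ⟨w, hw⟩ := hz
    change S w = z at hw
    obtain ⟨a, ha, b, hb, rfl⟩ := h.exists_add w
    rw [map_add] at hw
    have hSb : S b = z - S a := by rw [← hw]; abel
    have : S b = 0 := h.eq_zero_of_mem (hSb ▸ A.sub_mem z.2 (h.mapsTo_left a ha))
      (h.mapsTo_right b hb)
    exact ⟨⟨a, ha⟩, Subtype.ext (by rw [← hw, this, add_zero]; rfl)⟩

/-- A vector `y` generating a Jordan chain of length `m + 1`, together with a functional that
vanishes on the range of `S ^ (m + 1)` but not on the last vector of the chain, reduces `S`. -/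
theorem red_of_jordanChain {S : E →L[ℂ] E} {m : ℕ} {y : E} (hy : (S ^ (m + 1)) y = 0)
    {f : StrongDual ℂ E} (hf : ∀ x, f ((S ^ (m + 1)) x) = 0) (hfy : f ((S ^ m) y) ≠ 0) :
    ∃ A B : Submodule ℂ E, Red S A B ∧ (∀ x ∈ B, (S ^ (m + 1)) x = 0) ∧
      ∀ x ∈ A, ∀ i, f ((S ^ i) x) = 0 := by
  have hyi : ∀ i, m < i → (S ^ i) y = 0 := fun i hi => by
    obtain ⟨k, rfl⟩ := Nat.exists_eq_add_of_lt hi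
    rw [show m + k + 1 = k + (m + 1) by ring, pow_add_apply, hy, map_zero]
  have hfi : ∀ i, m < i → ∀ x, f ((S ^ i) x) = 0 := fun i hi x => by
    obtain ⟨k, rfl⟩ := Nat.exists_eq_add_of_lt hi
    rw [show m + k + 1 = (m + 1) + k by ring, pow_add_apply, hf]
  -- `A` is the largest `S`-invariant subspace of `ker f`. Its complement is the span `B 0` of the
  -- chain, filtered by the spans `B k` of its tails.
  let A : Submodule ℂ E := ⨅ i : ℕ, ((f ∘L S ^ i : E →L[ℂ] ℂ)).ker
  have hA : ∀ x, x ∈ A ↔ ∀ i, f ((S ^ i) x) = 0 := fun x => by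
    simp only [A, Submodule.mem_iInf, LinearMap.mem_ker]
    rfl
  let B : ℕ → Submodule ℂ E := fun k => Submodule.span ℂ {z | ∃ i, k ≤ i ∧ (S ^ i) y = z}
  have hBy : ∀ k i, k ≤ i → (S ^ i) y ∈ B k := fun k i hi => Submodule.subset_span ⟨i, hi, rfl⟩
  have hBmap : ∀ j k, ∀ x ∈ B k, (S ^ j) x ∈ B (j + k) := by
    intro j k x hx
    have : B k ≤ (B (j + k)).comap ((S ^ j : E →L[ℂ] E) : E →ₗ[ℂ] E) := by
      refine Submodule.span_le.mpr ?_
      rintro _ ⟨i, hi, rfl⟩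
      change (S ^ j) ((S ^ i) y) ∈ B (j + k)
      rw [← pow_add_apply]
      exact hBy _ _ (by omega)
    exact this hx
  have hBanti : ∀ k, B (k + 1) ≤ B k := fun k => Submodule.span_mono (by
    rintro _ ⟨i, hi, rfl⟩
    exact ⟨i, by omega, rfl⟩)
  have hBbot : B (m + 1) = ⊥ := by
    refine eq_bot_iff.mpr (Submodule.span_le.mpr ?_)
    rintro _ ⟨i, hi, rfl⟩
    exact hyi i hi
  have hBstep : ∀ k, ∀ x ∈ B k, ∃ c : ℂ, x - c • (S ^ k) y ∈ B (k + 1) := by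
    intro k x hx
    induction hx using Submodule.span_induction with
    | mem x h =>
      obtain ⟨i, hi, rfl⟩ := h
      rcases hi.eq_or_lt with rfl | hlt
      · exact ⟨1, by simp⟩
      · exact ⟨0, by simpa using hBy _ _ hlt⟩
    | zero => exact ⟨0, by simp⟩
    | add x z _ _ hx hz =>
      obtain ⟨c, hc⟩ := hx
      obtain ⟨d, hd⟩ := hz
      refine ⟨c + d, ?_⟩
      have := (B (k + 1)).add_mem hc hd
      convert this using 1
      module
    | smul a x _ hx =>
      obtain ⟨c, hc⟩ := hx
      refine ⟨a * c, ?_⟩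
      have := (B (k + 1)).smul_mem a hc
      convert this using 1
      module
  have hBfin : ∀ k, k ≤ m + 1 → FiniteDimensional ℂ (B k) := by
    intro k hk
    refine Nat.decreasingInduction (motive := fun k _ => FiniteDimensional ℂ (B k)) ?_ ?_ hk
    · intro k _ ih
      have : B k = B (k + 1) ⊔ Submodule.span ℂ {(S ^ k) y} := by
        refine le_antisymm (fun x hx => ?_) (sup_le (hBanti k) ?_)
        · obtain ⟨c, hc⟩ := hBstep k x hx
          rw [← sub_add_cancel x (c • (S ^ k) y)]
          exact Submodule.add_mem_sup hc (Submodule.smul_mem _ _ (Submodule.mem_span_singleton_self _))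
        · rw [Submodule.span_singleton_le_iff_mem]
          exact hBy k k le_rfl
      rw [this]
      infer_instance
    · rw [hBbot]
      infer_instance
  have hB0 := hBfin 0 (by omega)
  refine ⟨A, B 0, ⟨?_, ?_, ?_, ?_, ?_⟩, ?_, fun x hx => (hA x).mp hx⟩
  · have : (A : Set E) = ⋂ i : ℕ, ((f ∘L S ^ i : E →L[ℂ] ℂ).ker : Set E) := by
      simp [A]
    rw [this]
    exact isClosed_iInter fun i => (f ∘L S ^ i).isClosed_ker
  · exact Submodule.closed_of_finiteDimensional _
  · intro x hx
    rw [hA] at hx ⊢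
    intro i
    rw [← pow_succ_apply']
    exact hx _
  · intro x hx
    have := hBmap 1 0 x hx
    rw [pow_one] at this
    exact hBanti 0 this
  · constructor
    · rw [Submodule.disjoint_def]
      intro x hxA hxB
      rw [hA] at hxA
      -- If `x` in `A ∩ B k` has leading coefficient `c`, then `f (S ^ (m - k) x) = 0` reads `c * f
      -- (S ^ m y) = 0`, so `x` moves one step down the filtration.
      have : ∀ k, k ≤ m + 1 → x ∈ B k := by
        intro k
        induction k with
        | zero => exact fun _ => hxB
        | succ k ih =>
          intro hk
          obtain ⟨c, hc⟩ := hBstep k x (ih (by omega))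
          have h1 := hBmap (m - k) (k + 1) _ hc
          rw [show m - k + (k + 1) = m + 1 by omega, hBbot, Submodule.mem_bot, map_sub, map_smul,
            ← pow_add_apply, Nat.sub_add_cancel (by omega)] at h1
          have h2 := congrArg f h1
          rw [map_sub, hxA, map_smul, map_zero, zero_sub, neg_eq_zero, smul_eq_mul] at h2
          rcases mul_eq_zero.mp h2 with h | h
          · simpa [h] using hc
          · exact absurd h hfy
      have := this (m + 1) le_rfl
      rwa [hBbot] at this
    · rw [codisjoint_iff, eq_top_iff]
      intro x _
      -- The conditions are met from `i = m` downwards. A multiple of `S ^ k y` corrects the one for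
      -- `i = m - k` and leaves those for larger `i` intact, since `S ^ (i + k) y = 0` there.
      have key : ∀ k, k ≤ m + 1 → ∃ b ∈ B 0, ∀ i, m + 1 - k ≤ i → f ((S ^ i) (x - b)) = 0 := by
        intro k
        induction k with
        | zero => exact fun _ => ⟨0, Submodule.zero_mem _, fun i hi => hfi i (by omega) _⟩
        | succ k ih =>
          intro hk
          obtain ⟨b, hb, hbi⟩ := ih (by omega)
          set c := f ((S ^ (m - k)) (x - b)) / f ((S ^ m) y) with hc
          refine ⟨b + c • (S ^ k) y, Submodule.add_mem _ hb
            (Submodule.smul_mem _ _ (hBy 0 k (by omega))), fun i hi => ?_⟩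
          rw [← sub_sub, map_sub, map_sub, map_smul, map_smul, ← pow_add_apply, smul_eq_mul]
          by_cases hik : m + 1 - k ≤ i
          · rw [hbi i hik, hyi (i + k) (by omega)]
            simp
          · obtain rfl : i = m - k := by omega
            rw [Nat.sub_add_cancel (by omega), hc, div_mul_cancel₀ _ hfy, sub_self]
      obtain ⟨b, hb, hbi⟩ := key (m + 1) le_rfl
      rw [← sub_add_cancel x b]
      exact Submodule.add_mem_sup ((hA _).mpr fun i => hbi i (by omega)) hb
  · intro x hx
    have := hBmap (m + 1) 0 x hx
    rw [add_zero, hBbot] at this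
    exact this

end Kato

/-! ### Kato decomposition of semi-Fredholm operators. -/

section KatoDecomposition

open Filter Topology Function

universe u
variable {E : Type u} [NormedAddCommGroup E] [NormedSpace ℂ E] [CompleteSpace E]

/-- A semi-Fredholm operator that is not semi-regular has a nilpotent direct summand, and the other
summand is semi-Fredholm with smaller nullity or deficiency. -/
theorem IsSemiFredholm.exists_red_of_not_isSemiRegular {S : E →L[ℂ] E} (hS : IsSemiFredholm S)
    (hreg : ¬ IsSemiRegular S) :
    ∃ (A B : Submodule ℂ E) (h : Red S A B), (∃ n : ℕ, ∀ x ∈ B, (S ^ n) x = 0) ∧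
      (IsUpperSemiFredholm S → IsUpperSemiFredholm (S.restrict h.mapsTo_left) ∧
        Module.finrank ℂ (S.restrict h.mapsTo_left).ker < Module.finrank ℂ S.ker) ∧
      (IsLowerSemiFredholm S → IsLowerSemiFredholm (S.restrict h.mapsTo_left) ∧
        Module.finrank ℂ (A ⧸ (S.restrict h.mapsTo_left).range) <
          Module.finrank ℂ (E ⧸ S.range)) := by
  have hcl : IsClosed (S.range : Set E) := by
    simpa using hS.isClosed_range_pow 1
  have hex : ∃ n : ℕ, ¬ S.ker ≤ (S ^ n).range := by
    by_contra hne
    push Not at hne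
    exact hreg ⟨hcl, hne⟩
  classical
  -- With `m + 1` the least exponent whose range misses part of the kernel, a kernel vector outside
  -- `R(S ^ (m + 1))` still has the form `S ^ m y`. Hahn–Banach then gives the functional required
  -- by `red_of_jordanChain`.
  obtain ⟨m, hm⟩ : ∃ m, Nat.find hex = m + 1 := by
    refine Nat.exists_eq_succ_of_ne_zero fun h0 => ?_
    have := Nat.find_spec hex
    rw [h0] at this
    exact this fun x _ => ⟨x, by simp⟩
  have hle : S.ker ≤ (S ^ m).range := not_not.mp (Nat.find_min hex (m := m) (by omega))
  have hnle := Nat.find_spec hex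
  rw [hm] at hnle
  obtain ⟨x, hx, hxr⟩ := SetLike.not_le_iff_exists.mp hnle
  have hx0 : S x = 0 := hx
  obtain ⟨y, rfl⟩ := hle hx
  obtain ⟨f, hfy, hf⟩ := exists_dual_ne_zero_of_notMem (hS.isClosed_range_pow (m + 1)) hxr
  change f ((S ^ m) y) ≠ 0 at hfy
  change S ((S ^ m) y) = 0 at hx0
  obtain ⟨A, B, hred, hnil, hA⟩ := red_of_jordanChain (S := S) (m := m) (y := y)
    (by rw [pow_succ_apply, hx0]) (f := f) (fun x => hf _ ⟨x, rfl⟩) hfy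
  refine ⟨A, B, hred, ⟨_, hnil⟩, fun hup => ?_, fun hlow => ?_⟩
  · have hfin := hup.2
    obtain ⟨j, hj, hjv⟩ := hred.exists_ker_map
    refine ⟨⟨(isClosed_range_restrict_iff hred.isClosed_left _).mpr
      (hup.isClosed_map hred.isClosed_left), FiniteDimensional.of_injective j hj⟩, ?_⟩
    -- The kernel vector `S ^ m y` is not in `A`, because `f` does not vanish there.
    have hlt : j.range ≠ ⊤ := by
      intro htop
      obtain ⟨z, hz⟩ := LinearMap.range_eq_top.mp htop ⟨(S ^ m) y, hx0⟩
      have hz' : ((z : A) : E) = (S ^ m) y := (hjv z).symm.trans (congrArg Subtype.val hz)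
      have := hA _ (z : A).2 0
      rw [hz'] at this
      exact hfy this
    rw [← LinearMap.finrank_range_of_inj hj]
    exact Submodule.finrank_lt hlt
  · have hfin : FiniteDimensional ℂ (E ⧸ S.range) := hlow
    obtain ⟨j, hj, hjv⟩ := hred.exists_quotient_range_map
    refine ⟨FiniteDimensional.of_injective j hj, ?_⟩
    -- The class of `y` is missed: `y = z - S w` with `z` in `A` would give `f (S ^ m y) = 0`.
    have hlt : j.range ≠ ⊤ := by
      intro htop
      obtain ⟨z, hz⟩ := LinearMap.range_eq_top.mp htop (S.range.mkQ y)
      obtain ⟨z, rfl⟩ := Submodule.mkQ_surjective _ z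
      rw [Submodule.mkQ_apply, Submodule.mkQ_apply, hjv, Submodule.Quotient.eq] at hz
      obtain ⟨w, hw⟩ := hz
      change S w = z - y at hw
      have h1 : y = z - S w := by rw [hw]; abel
      apply hfy
      rw [h1, map_sub, map_sub, ← pow_succ_apply', hA _ z.2, show f ((S ^ (m + 1)) w) = 0 from hf _ ⟨w, rfl⟩,
        sub_zero]
    rw [← LinearMap.finrank_range_of_inj hj]
    exact Submodule.finrank_lt hlt

theorem Red.isSemiFredholm_left {S : E →L[ℂ] E} {A B : Submodule ℂ E} (h : Red S A B)
    (hS : IsSemiFredholm S) : IsSemiFredholm (S.restrict h.mapsTo_left) := by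
  refine hS.imp (fun hup => ?_) fun hlow => ?_
  · have := hup.2
    obtain ⟨j, hj, -⟩ := h.exists_ker_map
    exact ⟨(isClosed_range_restrict_iff h.isClosed_left _).mpr (hup.isClosed_map h.isClosed_left),
      FiniteDimensional.of_injective j hj⟩
  · have : FiniteDimensional ℂ (E ⧸ S.range) := hlow
    obtain ⟨j, hj, -⟩ := h.exists_quotient_range_map
    exact FiniteDimensional.of_injective j hj

/-- A decomposition of the left summand of a reducing pair refines the pair. -/
theorem Red.refine_left {T : E →L[ℂ] E} {M N : Submodule ℂ E} (h : Red T M N)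
    {A B : Submodule ℂ M} (h' : Red (T.restrict h.mapsTo_left) A B) :
    Red T (A.map M.subtype) (B.map M.subtype ⊔ N) := by
  refine ⟨?_, ?_, ?_, ?_, ?_, ?_⟩
  · exact h.isClosed_left.isClosedEmbedding_subtypeVal.isClosedMap _ h'.isClosed_left
  -- `B + N` is closed as the preimage of `B` under the bounded projection onto `M` along `N`.
  · let P := M.projectionOntoL N
      (Submodule.IsCompl.isTopCompl_of_isClosed h.isCompl h.isClosed_left h.isClosed_right)
    have hPm : ∀ x : M, P x = x := fun x => Submodule.projectionOnto_apply_left h.isCompl x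
    have hPn : ∀ x ∈ N, P x = 0 := fun x hx =>
      Submodule.projectionOnto_apply_right h.isCompl ⟨x, hx⟩
    have : ((B.map M.subtype ⊔ N : Submodule ℂ E) : Set E) = P ⁻¹' B := by
      ext x
      simp only [SetLike.mem_coe, Set.mem_preimage, Submodule.mem_sup]
      constructor
      · rintro ⟨_, ⟨b, hb, rfl⟩, n, hn, rfl⟩
        rw [map_add, hPn n hn, add_zero, Submodule.subtype_apply, hPm]
        exact hb
      · intro hx
        obtain ⟨a, ha, n, hn, rfl⟩ := h.exists_add x
        rw [map_add, hPn n hn, add_zero, hPm ⟨a, ha⟩] at hx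
        exact ⟨a, ⟨_, hx, rfl⟩, n, hn, rfl⟩
    rw [this]
    exact h'.isClosed_right.preimage P.continuous
  · rintro _ ⟨a, ha, rfl⟩
    exact ⟨_, h'.mapsTo_left a ha, rfl⟩
  · intro x hx
    obtain ⟨_, ⟨b, hb, rfl⟩, n, hn, rfl⟩ := Submodule.mem_sup.mp hx
    rw [map_add]
    exact Submodule.add_mem_sup ⟨_, h'.mapsTo_right b hb, rfl⟩ (h.mapsTo_right n hn)
  · rw [Submodule.disjoint_def]
    rintro _ ⟨a, ha, rfl⟩ hx
    obtain ⟨_, ⟨b, hb, rfl⟩, n, hn, hab⟩ := Submodule.mem_sup.mp hx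
    have hn' : n = ((a - b : M) : E) := by
      rw [Submodule.coe_sub]
      exact eq_sub_of_add_eq' hab
    have hn0 : ((a - b : M) : E) = 0 :=
      Submodule.disjoint_def.mp h.isCompl.disjoint _ (a - b).2 (hn' ▸ hn)
    have hab' : a = b := sub_eq_zero.mp (Subtype.ext hn0)
    have := Submodule.disjoint_def.mp h'.isCompl.disjoint a ha (hab' ▸ hb)
    rw [this, map_zero]
  · rw [codisjoint_iff, ← sup_assoc, ← Submodule.map_sup, h'.isCompl.sup_eq_top,
      Submodule.map_subtype_top, h.isCompl.sup_eq_top]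

omit [CompleteSpace E] in
theorem exists_pow_eq_zero_sup {T : E →L[ℂ] E} {P Q : Submodule ℂ E}
    (hP : ∃ n : ℕ, ∀ x ∈ P, (T ^ n) x = 0) (hQ : ∃ n : ℕ, ∀ x ∈ Q, (T ^ n) x = 0) :
    ∃ n : ℕ, ∀ x ∈ P ⊔ Q, (T ^ n) x = 0 := by
  obtain ⟨m, hm⟩ := hP
  obtain ⟨n, hn⟩ := hQ
  refine ⟨m + n, fun x hx => ?_⟩
  obtain ⟨p, hp, q, hq, rfl⟩ := Submodule.mem_sup.mp hx
  rw [map_add, pow_add_apply T m n q, hn q hq, map_zero, add_comm m, pow_add_apply, hm p hp,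
    map_zero, add_zero]

theorem Red.exists_isSemiRegular_refine {T : E →L[ℂ] E} {M N : Submodule ℂ E} (h : Red T M N)
    (hN : ∃ n : ℕ, ∀ x ∈ N, (T ^ n) x = 0)
    (hM : ∃ (A B : Submodule ℂ M) (h' : Red (T.restrict h.mapsTo_left) A B),
      IsSemiRegular ((T.restrict h.mapsTo_left).restrict h'.mapsTo_left) ∧
      IsNilpotent ((T.restrict h.mapsTo_left).restrict h'.mapsTo_right)) :
    ∃ (A B : Submodule ℂ E) (h' : Red T A B),
      IsSemiRegular (T.restrict h'.mapsTo_left) ∧ IsNilpotent (T.restrict h'.mapsTo_right) := by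
  obtain ⟨A, B, h', hA, hB⟩ := hM
  refine ⟨_, _, h.refine_left h', ?_, ?_⟩
  · rw [isSemiRegular_restrict_iff h'.isClosed_left] at hA
    rw [isSemiRegular_restrict_iff (h.refine_left h').isClosed_left]
    constructor
    · convert h.isClosed_left.isClosedEmbedding_subtypeVal.isClosedMap _ hA.1 using 1
      ext x
      constructor
      · rintro ⟨_, ⟨a, ha, rfl⟩, rfl⟩
        exact ⟨_, ⟨a, ha, rfl⟩, rfl⟩
      · rintro ⟨_, ⟨a, ha, rfl⟩, rfl⟩
        exact ⟨_, ⟨a, ha, rfl⟩, rfl⟩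
    · rintro n _ ⟨a, ha, rfl⟩ hTa
      obtain ⟨b, hb, hba⟩ := hA.2 n a ha (Subtype.ext hTa)
      refine ⟨b, ⟨b, hb, rfl⟩, ?_⟩
      rw [← coe_restrict_pow h.mapsTo_left, hba]
      rfl
  · rw [isNilpotent_restrict_iff] at hB ⊢
    obtain ⟨n, hn⟩ := hB
    refine exists_pow_eq_zero_sup ⟨n, ?_⟩ hN
    rintro _ ⟨b, hb, rfl⟩
    rw [Submodule.subtype_apply, ← coe_restrict_pow h.mapsTo_left, hn b hb]
    rfl

omit [CompleteSpace E] in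
theorem IsSemiRegular.exists_red {S : E →L[ℂ] E} (hS : IsSemiRegular S) :
    ∃ (A B : Submodule ℂ E) (h : Red S A B),
      IsSemiRegular (S.restrict h.mapsTo_left) ∧ IsNilpotent (S.restrict h.mapsTo_right) := by
  refine ⟨⊤, ⊥, ⟨isClosed_univ, isClosed_singleton, by simp, by simp, isCompl_top_bot⟩, ?_, ?_⟩
  · rw [isSemiRegular_restrict_iff isClosed_univ]
    refine ⟨?_, fun n x _ hx => ?_⟩
    · rw [Submodule.map_top]
      exact hS.1
    · obtain ⟨y, hy⟩ := hS.2 n hx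
      exact ⟨y, trivial, hy⟩
  · rw [isNilpotent_restrict_iff]
    exact ⟨0, by simp⟩

/-- Kato decomposition: a semi-Fredholm operator is the direct sum of a semi-regular operator and a
nilpotent operator. -/
theorem IsSemiFredholm.exists_kato {S : E →L[ℂ] E} (hS : IsSemiFredholm S) :
    ∃ (A B : Submodule ℂ E) (h : Red S A B),
      IsSemiRegular (S.restrict h.mapsTo_left) ∧ IsNilpotent (S.restrict h.mapsTo_right) := by
  -- Induction on the nullity or the deficiency, whichever is known to be finite. The space is
  -- quantified because the induction passes to the summand `A`.
  suffices H : ∀ (n : ℕ) (E : Type u) [NormedAddCommGroup E] [NormedSpace ℂ E] [CompleteSpace E]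
      (S : E →L[ℂ] E), (IsUpperSemiFredholm S ∧ Module.finrank ℂ S.ker = n) ∨
        (IsLowerSemiFredholm S ∧ Module.finrank ℂ (E ⧸ S.range) = n) →
      ∃ (A B : Submodule ℂ E) (h : Red S A B),
        IsSemiRegular (S.restrict h.mapsTo_left) ∧ IsNilpotent (S.restrict h.mapsTo_right) by
    rcases hS with hS | hS
    · exact H _ E S (Or.inl ⟨hS, rfl⟩)
    · exact H _ E S (Or.inr ⟨hS, rfl⟩)
  intro n
  induction n using Nat.strong_induction_on with
  | _ n ih =>
    intro E _ _ _ S hS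
    by_cases hreg : IsSemiRegular S
    · exact hreg.exists_red
    obtain ⟨A, B, h, hB, hup, hlow⟩ := IsSemiFredholm.exists_red_of_not_isSemiRegular
      (hS.imp And.left And.left) hreg
    have : CompleteSpace A := h.isClosed_left.completeSpace_coe
    refine h.exists_isSemiRegular_refine hB ?_
    rcases hS with ⟨hS, hn⟩ | ⟨hS, hn⟩
    · exact ih _ (hn ▸ (hup hS).2) A _ (Or.inl ⟨(hup hS).1, rfl⟩)
    · exact ih _ (hn ▸ (hlow hS).2) A _ (Or.inr ⟨(hlow hS).1, rfl⟩)

end KatoDecomposition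

/-! ### Quasi-nilpotent semi-Fredholm operators are nilpotent. -/

section QuasiNilpotent

open Filter Topology Function

universe u
variable {E : Type u} [NormedAddCommGroup E] [NormedSpace ℂ E]

theorem isQuasiNilpotent_iff [CompleteSpace E] {S : E →L[ℂ] E} :
    IsQuasiNilpotent S ↔ ∀ c : ℂ, c ≠ 0 → Bijective (S - c • (1 : E →L[ℂ] E)) := by
  refine forall_congr' fun c => ?_
  rw [spectrum.mem_iff, Algebra.algebraMap_eq_smul_one, ← IsUnit.neg_iff, neg_sub,
    ContinuousLinearMap.isUnit_iff_bijective, Set.mem_singleton_iff, not_imp_comm]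

theorem IsNilpotent.isQuasiNilpotent {S : E →L[ℂ] E} (hS : IsNilpotent S) :
    IsQuasiNilpotent S := by
  intro c hc
  by_contra hne
  rw [spectrum.mem_iff] at hc
  apply hc
  rw [sub_eq_add_neg]
  have hne' : c ≠ 0 := hne
  exact hS.neg.isUnit_add_left_of_commute ((isUnit_iff_ne_zero.mpr hne').map _)
    (Algebra.commutes' c (-S)).symm

theorem index_eq_zero_of_bijective {S : E →L[ℂ] E} (hS : Bijective S) : index S = 0 := by
  have h1 : nullity S = 0 := (kernelDim_eq_zero_iff (f := (S : E →ₗ[ℂ] E))).mpr hS.1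
  have h2 : deficiency S = 0 := (cokernelDim_eq_zero_iff (f := (S : E →ₗ[ℂ] E))).mpr hS.2
  simp [index, h1, h2]

theorem Red.bijective_restrict_sub {S : E →L[ℂ] E} {A B : Submodule ℂ E} (h : Red S A B) {c : ℂ}
    (hS : Bijective (S - c • (1 : E →L[ℂ] E))) :
    Bijective (S.restrict h.mapsTo_left - c • (1 : A →L[ℂ] A)) := by
  constructor
  · intro x y hxy
    exact Subtype.ext (hS.1 (congrArg Subtype.val hxy))
  · intro x
    obtain ⟨w, hw⟩ := hS.2 x
    obtain ⟨a, ha, b, hb, rfl⟩ := h.exists_add w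
    change S (a + b) - c • (a + b) = x at hw
    have h1 : S b - c • b = x - (S a - c • a) := by
      rw [← hw, map_add]
      module
    have h2 : S b - c • b = 0 := h.eq_zero_of_mem
      (h1 ▸ A.sub_mem x.2 (A.sub_mem (h.mapsTo_left a ha) (A.smul_mem c ha)))
      (B.sub_mem (h.mapsTo_right b hb) (B.smul_mem c hb))
    refine ⟨⟨a, ha⟩, Subtype.ext ?_⟩
    change S a - c • a = x
    rw [h2] at h1
    exact (sub_eq_zero.mp h1.symm).symm

variable [CompleteSpace E]

/-- `P = ⋂ R(S ^ n)` is closed, contains `ker S`, and `S` maps it onto itself. The kernel dimension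
is locally constant at a surjective operator and is zero for `S - c` on `P`, so it is zero for `S`.
-/
theorem IsSemiRegular.injective_of_bijective_sub {S : E →L[ℂ] E} (hS : IsSemiFredholm S)
    (hreg : IsSemiRegular S) (hq : ∀ c : ℂ, c ≠ 0 → Bijective (S - c • (1 : E →L[ℂ] E))) :
    Injective S := by
  let P : Submodule ℂ E := ⨅ n : ℕ, (S ^ n).range
  have hPcl : IsClosed (P : Set E) := by
    have : (P : Set E) = ⋂ n : ℕ, ((S ^ n).range : Set E) := by simp [P]
    rw [this]
    exact isClosed_iInter hS.isClosed_range_pow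
  have : CompleteSpace P := hPcl.completeSpace_coe
  have hmem : ∀ x, x ∈ P ↔ ∀ n, x ∈ (S ^ n).range := fun x => Submodule.mem_iInf _
  have hmaps : ∀ x ∈ P, S x ∈ P := fun x hx =>
    (hmem _).mpr fun n => mapsTo_range_pow S n x ((hmem x).mp hx n)
  have hker : S.ker ≤ P := fun x hx => (hmem x).mpr fun n => hreg.2 n hx
  have hsurj : Surjective (S.restrict hmaps) := by
    rintro ⟨x, hx⟩
    have hpre : ∀ n, ∃ y, S ((S ^ n) y) = x := fun n => by
      obtain ⟨y, hy⟩ := (hmem x).mp hx (n + 1)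
      exact ⟨y, (pow_succ_apply S n y).symm.trans hy⟩
    obtain ⟨y, hy⟩ := hpre 0
    suffices hP : (S ^ 0) y ∈ P from ⟨⟨(S ^ 0) y, hP⟩, Subtype.ext hy⟩
    -- Two preimages of `x` differ by a kernel vector, which semi-regularity places in `R(S ^ n)`;
    -- one of them is `S ^ n z`.
    refine (hmem _).mpr fun n => ?_
    obtain ⟨z, hz⟩ := hpre n
    have hd : (S ^ 0) y - (S ^ n) z ∈ S.ker := by
      rw [LinearMap.mem_ker]
      change S ((S ^ 0) y - (S ^ n) z) = 0
      rw [map_sub, hy, hz, sub_self]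
    rw [← sub_add_cancel ((S ^ 0) y) ((S ^ n) z)]
    exact Submodule.add_mem _ (hreg.2 n hd) ⟨z, rfl⟩
  have hev := (tendsto_sub_smul_one (S.restrict hmaps)).eventually
    (eventually_surjective_kernelDim_eq hsurj)
  obtain ⟨c, ⟨-, hc⟩, hc0⟩ :=
    ((hev.filter_mono nhdsWithin_le_nhds).and (self_mem_nhdsWithin (s := {(0 : ℂ)}ᶜ))).exists
  have hinj : Injective (S.restrict hmaps - c • (1 : P →L[ℂ] P)) := fun x y hxy =>
    Subtype.ext ((hq c hc0).1 (congrArg Subtype.val hxy))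
  rw [kernelDim_eq_zero_iff.mpr (show Injective
    ((S.restrict hmaps - c • (1 : P →L[ℂ] P) : P →L[ℂ] P) : P →ₗ[ℂ] P) from hinj)] at hc
  have hinj' : Injective (S.restrict hmaps) := kernelDim_eq_zero_iff.mp hc.symm
  rw [injective_iff_map_eq_zero]
  intro x hx
  exact congrArg Subtype.val ((injective_iff_map_eq_zero _).mp hinj' ⟨x, hker hx⟩ (Subtype.ext hx))

/-- By stability the index is that of the bijective `S - c`, namely zero, so the injective `S` is
bijective. Its spectrum is then empty, which is possible only on the zero space. -/
theorem IsSemiRegular.subsingleton_of_bijective_sub {S : E →L[ℂ] E} (hS : IsSemiFredholm S)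
    (hreg : IsSemiRegular S) (hq : ∀ c : ℂ, c ≠ 0 → Bijective (S - c • (1 : E →L[ℂ] E))) :
    Subsingleton E := by
  have hinj := hreg.injective_of_bijective_sub hS hq
  obtain ⟨c, hc, hc0⟩ := ((hS.eventually_index_eq.filter_mono nhdsWithin_le_nhds).and
    (self_mem_nhdsWithin (s := {(0 : ℂ)}ᶜ))).exists
  rw [index_eq_zero_of_bijective (hq c hc0)] at hc
  have h1 : nullity S = 0 := (kernelDim_eq_zero_iff (f := (S : E →ₗ[ℂ] E))).mpr hinj
  have h2 : deficiency S = 0 := by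
    have : -((deficiency S : ENNReal) : EReal) = 0 := by simpa [index, h1] using hc.symm
    rw [EReal.neg_eq_zero_iff] at this
    simpa using this
  have hsurj : Surjective S := (cokernelDim_eq_zero_iff (f := (S : E →ₗ[ℂ] E))).mp h2
  by_contra hne
  rw [not_subsingleton_iff_nontrivial] at hne
  obtain ⟨d, hd⟩ := spectrum.nonempty S
  have hd0 : d = 0 := isQuasiNilpotent_iff.mpr hq hd
  rw [hd0, spectrum.zero_mem_iff] at hd
  exact hd (ContinuousLinearMap.isUnit_iff_bijective.mpr ⟨hinj, hsurj⟩)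

/-- A quasi-nilpotent semi-Fredholm operator is nilpotent. -/
theorem IsSemiFredholm.isNilpotent_of_bijective_sub {S : E →L[ℂ] E} (hS : IsSemiFredholm S)
    (hq : ∀ c : ℂ, c ≠ 0 → Bijective (S - c • (1 : E →L[ℂ] E))) : IsNilpotent S := by
  obtain ⟨A, B, h, hA, hB⟩ := hS.exists_kato
  have : CompleteSpace A := h.isClosed_left.completeSpace_coe
  have := hA.subsingleton_of_bijective_sub (h.isSemiFredholm_left hS)
    fun c hc => h.bijective_restrict_sub (hq c hc)
  obtain ⟨n, hn⟩ := (isNilpotent_restrict_iff _).mp hB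
  refine ⟨n, ?_⟩
  ext x
  obtain ⟨a, ha, b, hb, rfl⟩ := h.exists_add x
  have ha0 : a = 0 := congrArg Subtype.val (Subsingleton.elim (⟨a, ha⟩ : A) 0)
  rw [ha0, zero_add, hn b hb]
  rfl

end QuasiNilpotent

/-! ### Comparison of indices and the two implications. -/

section Main

open Filter Topology Function

universe u
variable {E : Type u} [NormedAddCommGroup E] [NormedSpace ℂ E]

/-- The hypotheses say that `T - c` is bijective on `E / P`. They are met by `P = R(T ^ n)`, where
the quotient operator is nilpotent, and by `P = M`, where it is `T_N`. -/
theorem index_restrict_sub_eq {T : E →L[ℂ] E} {P : Submodule ℂ E} (h : ∀ x ∈ P, T x ∈ P) {c : ℂ}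
    (hinj : ∀ w, T w - c • w ∈ P → w ∈ P) (hsurj : ∀ x, ∃ w, x - (T w - c • w) ∈ P) :
    index (T.restrict h - c • (1 : P →L[ℂ] P)) = index (T - c • (1 : E →L[ℂ] E)) := by
  obtain ⟨h1, h2⟩ := kernelDim_cokernelDim_restrict
    (G := ((T - c • (1 : E →L[ℂ] E) : E →L[ℂ] E) : E →ₗ[ℂ] E))
    (H := ((T.restrict h - c • (1 : P →L[ℂ] P) : P →L[ℂ] P) : P →ₗ[ℂ] P))
    (fun x => rfl) hinj hsurj
  have h1' : nullity (T.restrict h - c • (1 : P →L[ℂ] P)) = nullity (T - c • (1 : E →L[ℂ] E)) := h1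
  have h2' : deficiency (T.restrict h - c • (1 : P →L[ℂ] P)) =
      deficiency (T - c • (1 : E →L[ℂ] E)) := h2
  rw [index, index, h1', h2']

theorem index_rangeRestriction_sub_eq (T : E →L[ℂ] E) (n : ℕ) {c : ℂ} (hc : c ≠ 0) :
    index (rangeRestriction T n - c • 1) = index (T - c • (1 : E →L[ℂ] E)) := by
  refine index_restrict_sub_eq _ (fun w hw => ?_) fun x => ?_
  · have key : ∀ k, k ≤ n → w ∈ (T ^ k).range := by
      intro k
      induction k with
      | zero => exact fun _ => ⟨w, by simp⟩
      | succ k ih =>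
        intro hk
        obtain ⟨z, hz⟩ := ih (by omega)
        obtain ⟨r, hr⟩ := hw
        change (T ^ k) z = w at hz
        change (T ^ n) r = T w - c • w at hr
        obtain ⟨j, rfl⟩ := Nat.exists_eq_add_of_le hk
        -- Solves `c w = T w - T ^ n r` with `w = T ^ k z` and `n = k + 1 + j`.
        refine ⟨c⁻¹ • (z - (T ^ j) r), ?_⟩
        change (T ^ (k + 1)) (c⁻¹ • (z - (T ^ j) r)) = w
        rw [map_smul, map_sub, ← pow_add_apply, hr, pow_succ_apply, hz, sub_sub_cancel,
          inv_smul_smul₀ hc]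
    exact key n le_rfl
  · induction n with
    | zero => exact ⟨0, x, by simp⟩
    | succ n ih =>
      obtain ⟨w, z, hz⟩ := ih
      change (T ^ n) z = x - (T w - c • w) at hz
      -- This correction turns the remainder `T ^ n z` into `c⁻¹ T ^ (n + 1) z`.
      refine ⟨w - c⁻¹ • (T ^ n) z, c⁻¹ • z, ?_⟩
      change (T ^ (n + 1)) (c⁻¹ • z) = _
      have : x = (T ^ n) z + (T w - c • w) := by rw [hz]; abel
      rw [map_smul, pow_succ_apply, map_sub, map_smul, smul_sub, smul_smul, mul_inv_cancel₀ hc,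
        one_smul]
      rw [this]
      abel

theorem Red.index_restrict_sub_eq {T : E →L[ℂ] E} {M N : Submodule ℂ E} (h : Red T M N) {c : ℂ}
    (hN : Bijective (T.restrict h.mapsTo_right - c • (1 : N →L[ℂ] N))) :
    index (T.restrict h.mapsTo_left - c • (1 : M →L[ℂ] M)) = index (T - c • (1 : E →L[ℂ] E)) := by
  refine FredholmTheory.index_restrict_sub_eq _ (fun w hw => ?_) fun x => ?_
  · obtain ⟨m, hm, n, hn, rfl⟩ := h.exists_add w
    have h1 : T n - c • n = (T (m + n) - c • (m + n)) - (T m - c • m) := by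
      rw [map_add]
      module
    have h2 : T n - c • n = 0 := h.eq_zero_of_mem
      (h1 ▸ M.sub_mem hw (M.sub_mem (h.mapsTo_left m hm) (M.smul_mem c hm)))
      (N.sub_mem (h.mapsTo_right n hn) (N.smul_mem c hn))
    have h3 := (injective_iff_map_eq_zero _).mp hN.1 ⟨n, hn⟩ (Subtype.ext h2)
    have h4 : n = 0 := congrArg Subtype.val h3
    rwa [h4, add_zero]
  · obtain ⟨m, hm, n, hn, rfl⟩ := h.exists_add x
    obtain ⟨w, hw⟩ := hN.2 ⟨n, hn⟩
    refine ⟨w, ?_⟩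
    have : T w - c • (w : E) = n := congrArg Subtype.val hw
    rw [this, add_sub_cancel_right]
    exact hm

variable [CompleteSpace E]

theorem IsSemiBFredholmIndex.eventually_eq {T : E →L[ℂ] E} {k : EReal}
    (h : IsSemiBFredholmIndex T k) :
    ∀ᶠ c : ℂ in 𝓝[≠] 0, index (T - c • (1 : E →L[ℂ] E)) = k := by
  obtain ⟨n, ⟨hcl, hS⟩, rfl⟩ := h
  have : CompleteSpace (T ^ n).range := hcl.completeSpace_coe
  filter_upwards [hS.eventually_index_eq.filter_mono nhdsWithin_le_nhds, self_mem_nhdsWithin]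
    with c hc hc0
  rw [← hc, index_rangeRestriction_sub_eq T n hc0]

theorem IsPseudoSemiBFredholmIndex.eventually_eq {T : E →L[ℂ] E} {k : EReal}
    (h : IsPseudoSemiBFredholmIndex T k) :
    ∀ᶠ c : ℂ in 𝓝[≠] 0, index (T - c • (1 : E →L[ℂ] E)) = k := by
  obtain ⟨M, N, h, hM, hN, rfl⟩ := h
  have : CompleteSpace M := h.isClosed_left.completeSpace_coe
  have : CompleteSpace N := h.isClosed_right.completeSpace_coe
  filter_upwards [hM.eventually_index_eq.filter_mono nhdsWithin_le_nhds, self_mem_nhdsWithin]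
    with c hc hc0
  rw [← hc, h.index_restrict_sub_eq (isQuasiNilpotent_iff.mp hN c hc0)]

omit [CompleteSpace E] in
theorem eq_of_eventually_index_eq {T : E →L[ℂ] E} {j k : EReal}
    (hj : ∀ᶠ c : ℂ in 𝓝[≠] 0, index (T - c • (1 : E →L[ℂ] E)) = j)
    (hk : ∀ᶠ c : ℂ in 𝓝[≠] 0, index (T - c • (1 : E →L[ℂ] E)) = k) : j = k := by
  obtain ⟨c, hc, hc'⟩ := (hj.and hk).exists
  exact hc.symm.trans hc'

omit [CompleteSpace E] in
theorem Red.range_pow {T : E →L[ℂ] E} {M N : Submodule ℂ E} (h : Red T M N) (n : ℕ) :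
    Red (rangeRestriction T n) (M.comap (T ^ n).range.subtype) (N.comap (T ^ n).range.subtype) := by
  refine ⟨h.isClosed_left.preimage continuous_subtype_val,
    h.isClosed_right.preimage continuous_subtype_val,
    fun x hx => h.mapsTo_left x hx, fun x hx => h.mapsTo_right x hx, ?_, ?_⟩
  · rw [Submodule.disjoint_def]
    exact fun x hxM hxN => Subtype.ext (h.eq_zero_of_mem hxM hxN)
  · rw [codisjoint_iff, eq_top_iff]
    rintro ⟨_, x, rfl⟩ -
    obtain ⟨m, hm, k, hk, rfl⟩ := h.exists_add x
    refine Submodule.mem_sup.mpr ⟨⟨(T ^ n) m, m, rfl⟩, pow_mem_of_mapsTo h.mapsTo_left n hm,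
      ⟨(T ^ n) k, k, rfl⟩, pow_mem_of_mapsTo h.mapsTo_right n hk, Subtype.ext ?_⟩
    exact (map_add (T ^ n) m k).symm

/-- On `N ∩ R(T ^ n)` the operator is a summand of `T_[n]` and is quasi-nilpotent, hence nilpotent
of some order `d`. Since `T ^ n` maps `N` into this space, `T ^ (d + n)` vanishes on `N`. -/
theorem IsSemiBFredholmAt.isNilpotent_right {T : E →L[ℂ] E} {n : ℕ} (hT : IsSemiBFredholmAt T n)
    {M N : Submodule ℂ E} (h : Red T M N) (hN : IsQuasiNilpotent (T.restrict h.mapsTo_right)) :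
    IsNilpotent (T.restrict h.mapsTo_right) := by
  have hR : CompleteSpace (T ^ n).range := hT.1.completeSpace_coe
  have hNc : CompleteSpace N := h.isClosed_right.completeSpace_coe
  have hr := (h.range_pow n).symm
  have hrc : CompleteSpace (N.comap (T ^ n).range.subtype) := hr.isClosed_left.completeSpace_coe
  have hbij := isQuasiNilpotent_iff.mp hN
  have hnil := (hr.isSemiFredholm_left hT.2).isNilpotent_of_bijective_sub fun c hc => by
    constructor
    · intro x y hxy
      have h1 := (hbij c hc).1 (a₁ := ⟨x, x.2⟩) (a₂ := ⟨y, y.2⟩)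
        (Subtype.ext (congrArg (fun v => ((v : (T ^ n).range) : E)) (congrArg Subtype.val hxy)))
      exact Subtype.ext (Subtype.ext (congrArg (fun v : N => (v : E)) h1))
    · rintro ⟨⟨_, x, rfl⟩, hx⟩
      obtain ⟨m, hm, k, hk, rfl⟩ := h.exists_add x
      change (T ^ n) (m + k) ∈ N at hx
      rw [map_add] at hx
      -- Only the component `k` in `N` matters, so applying `T ^ n` to a solution `w` in `N` of `T w
      -- - c w = k` solves the equation inside `N ∩ R(T ^ n)`.
      have hm0 : (T ^ n) m = 0 := h.eq_zero_of_mem (pow_mem_of_mapsTo h.mapsTo_left n hm)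
        ((N.add_mem_iff_left (pow_mem_of_mapsTo h.mapsTo_right n hk)).mp hx)
      obtain ⟨w, hw⟩ := (hbij c hc).2 ⟨k, hk⟩
      have hw' : T w - c • (w : E) = k := congrArg Subtype.val hw
      refine ⟨⟨⟨(T ^ n) w, w, rfl⟩, pow_mem_of_mapsTo h.mapsTo_right n w.2⟩,
        Subtype.ext (Subtype.ext ?_)⟩
      change T ((T ^ n) w) - c • (T ^ n) w = (T ^ n) (m + k)
      rw [map_add, hm0, zero_add, ← hw', map_sub, map_smul, ← pow_succ_apply, pow_succ_apply']
  obtain ⟨d, hd⟩ := (isNilpotent_restrict_iff _).mp hnil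
  refine (isNilpotent_restrict_iff _).mpr ⟨d + n, fun x hx => ?_⟩
  have := congrArg Subtype.val
    (hd ⟨(T ^ n) x, x, rfl⟩ (pow_mem_of_mapsTo h.mapsTo_right n hx))
  rw [rangeRestriction, coe_restrict_pow] at this
  rw [pow_add_apply]
  exact this

-- If `S ^ (n + 1) x = 0`, then `S ^ n x` is a kernel vector, hence equals `S ^ (n + m) y`; so `x`
-- is `S ^ m y` up to an element of `ker (S ^ n)`.
omit [CompleteSpace E] in
theorem IsSemiRegular.ker_pow_le {S : E →L[ℂ] E} (hS : IsSemiRegular S) (n : ℕ) :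
    (S ^ n).ker ≤ S.range := by
  suffices H : ∀ n m : ℕ, (S ^ n).ker ≤ (S ^ m).range by
    simpa using H n 1
  intro n
  induction n with
  | zero =>
    intro m x hx
    have : x = 0 := by simpa using hx
    rw [this]
    exact Submodule.zero_mem _
  | succ n ih =>
    intro m x hx
    have hx' : S ((S ^ n) x) = 0 := (pow_succ_apply S n x).symm.trans hx
    obtain ⟨y, hy⟩ := hS.2 (n + m) hx'
    change (S ^ (n + m)) y = (S ^ n) x at hy
    have : x - (S ^ m) y ∈ (S ^ n).ker := by
      rw [LinearMap.mem_ker]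
      change (S ^ n) (x - (S ^ m) y) = 0
      rw [map_sub, ← pow_add_apply, hy, sub_self]
    rw [← sub_add_cancel x ((S ^ m) y)]
    exact Submodule.add_mem _ (ih m this) ⟨y, rfl⟩

-- Semi-regularity embeds `ker T_M` into `ker T_[n]`. It also puts `ker (T_M ^ n)` inside `R(T_M)`,
-- which makes the map of cokernels induced by `T ^ n` injective.
omit [CompleteSpace E] in
theorem IsSemiBFredholmAt.isSemiFredholm_left {T : E →L[ℂ] E} {n : ℕ} (hT : IsSemiBFredholmAt T n)
    {M N : Submodule ℂ E} (h : Red T M N) (hM : IsSemiRegular (T.restrict h.mapsTo_left)) :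
    IsSemiFredholm (T.restrict h.mapsTo_left) := by
  refine hT.2.imp (fun hup => ⟨hM.1, ?_⟩) fun hlow => ?_
  · have := hup.2
    have hker : ∀ z : (T.restrict h.mapsTo_left).ker, T (z : M) = 0 := fun z =>
      congrArg Subtype.val z.2
    let j : (T.restrict h.mapsTo_left).ker →ₗ[ℂ] (rangeRestriction T n).ker :=
      { toFun := fun z => ⟨⟨(z : M), by
          obtain ⟨y, hy⟩ := hM.2 n z.2
          refine ⟨y, ?_⟩
          rw [← hy]
          exact (coe_restrict_pow h.mapsTo_left n y).symm⟩,
          Subtype.ext (hker z)⟩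
        map_add' := fun _ _ => rfl
        map_smul' := fun _ _ => rfl }
    refine FiniteDimensional.of_injective j fun x y hxy => ?_
    exact Subtype.ext (Subtype.ext
      (congrArg (fun v : (rangeRestriction T n).ker => ((v : (T ^ n).range) : E)) hxy))
  · have : FiniteDimensional ℂ ((T ^ n).range ⧸ (rangeRestriction T n).range) := hlow
    let p : M →ₗ[ℂ] (T ^ n).range := ((T ^ n : E →L[ℂ] E) : E →ₗ[ℂ] E).rangeRestrict ∘ₗ M.subtype
    let j := Submodule.mapQ (T.restrict h.mapsTo_left).range (rangeRestriction T n).range p (by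
      rintro _ ⟨z, rfl⟩
      refine ⟨p z, Subtype.ext ?_⟩
      exact (pow_succ_apply T n z).symm.trans (pow_succ_apply' T n z))
    have hj : Injective j := by
      rw [← LinearMap.ker_eq_bot, LinearMap.ker_eq_bot']
      intro z hz
      obtain ⟨z, rfl⟩ := Submodule.mkQ_surjective _ z
      simp only [j, Submodule.mkQ_apply, Submodule.mapQ_apply, Submodule.Quotient.mk_eq_zero]
        at hz ⊢
      obtain ⟨⟨_, w, rfl⟩, hw⟩ := hz
      have hw' : T ((T ^ n) w) = (T ^ n) z := congrArg Subtype.val hw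
      obtain ⟨a, ha, b, hb, rfl⟩ := h.exists_add w
      rw [← pow_succ_apply, pow_succ_apply', map_add] at hw'
      have h1 : (T ^ n) (T b) = (T ^ n) (z - T a) := by
        rw [map_sub, ← hw', map_add]
        abel
      have h2 : (T ^ n) (T b) = 0 := h.eq_zero_of_mem
        (h1 ▸ pow_mem_of_mapsTo h.mapsTo_left n (M.sub_mem z.2 (h.mapsTo_left a ha)))
        (pow_mem_of_mapsTo h.mapsTo_right n (h.mapsTo_right b hb))
      let a' : M := ⟨a, ha⟩
      have h3 : z - T.restrict h.mapsTo_left a' ∈ ((T.restrict h.mapsTo_left) ^ n).ker := by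
        rw [LinearMap.mem_ker]
        refine Subtype.ext ((coe_restrict_pow h.mapsTo_left n _).trans ?_)
        exact h1.symm.trans h2
      rw [← sub_add_cancel z (T.restrict h.mapsTo_left a')]
      exact Submodule.add_mem _ (hM.ker_pow_le n h3) ⟨a', rfl⟩
    exact FiniteDimensional.of_injective j hj

omit [CompleteSpace E] in
theorem Red.exists_pow_left_eq {T : E →L[ℂ] E} {M N : Submodule ℂ E} (h : Red T M N) {d : ℕ}
    (hN : ∀ x ∈ N, (T ^ d) x = 0) {n : ℕ} (hn : d ≤ n) (x : E) :
    ∃ m : M, (T ^ n) m = (T ^ n) x := by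
  obtain ⟨m, hm, k, hk, rfl⟩ := h.exists_add x
  obtain ⟨j, rfl⟩ := Nat.exists_eq_add_of_le hn
  refine ⟨⟨m, hm⟩, ?_⟩
  rw [map_add, add_comm d, pow_add_apply T j d k, hN k hk, map_zero, add_zero]

theorem Red.isClosed_range_pow {T : E →L[ℂ] E} {M N : Submodule ℂ E} (h : Red T M N) {d : ℕ}
    (hN : ∀ x ∈ N, (T ^ d) x = 0) (hM : IsSemiFredholm (T.restrict h.mapsTo_left)) {n : ℕ}
    (hn : d ≤ n) : IsClosed ((T ^ n).range : Set E) := by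
  have : CompleteSpace M := h.isClosed_left.completeSpace_coe
  convert h.isClosed_left.isClosedEmbedding_subtypeVal.isClosedMap _ (hM.isClosed_range_pow n)
    using 1
  ext x
  constructor
  · rintro ⟨y, rfl⟩
    obtain ⟨m, hm⟩ := h.exists_pow_left_eq hN hn y
    exact ⟨_, ⟨m, rfl⟩, (coe_restrict_pow h.mapsTo_left n m).trans hm⟩
  · rintro ⟨_, ⟨m, rfl⟩, rfl⟩
    exact ⟨m, (coe_restrict_pow h.mapsTo_left n m).symm⟩

/-- As `T ^ d` kills `N`, its range is `T ^ d (M)`, inside `M`. So `ker T_[d]` embeds into `ker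
T_M`, and `T ^ d` induces a surjection from the cokernel of `T_M` onto that of `T_[d]`. -/
theorem Red.isSemiBFredholmAt {T : E →L[ℂ] E} {M N : Submodule ℂ E} (h : Red T M N) {d : ℕ}
    (hN : ∀ x ∈ N, (T ^ d) x = 0) (hM : IsSemiFredholm (T.restrict h.mapsTo_left)) :
    IsSemiBFredholmAt T d := by
  refine ⟨h.isClosed_range_pow hN hM le_rfl, hM.imp (fun hup => ⟨?_, ?_⟩) fun hlow => ?_⟩
  · have heq : (rangeRestriction T d).range =
        (T ^ (d + 1)).range.comap (T ^ d).range.subtype := by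
      ext x
      constructor
      · rintro ⟨⟨_, z, rfl⟩, rfl⟩
        exact ⟨z, pow_succ_apply T d z⟩
      · rintro ⟨z, hz⟩
        exact ⟨⟨(T ^ d) z, z, rfl⟩, Subtype.ext ((pow_succ_apply T d z).symm.trans hz)⟩
    rw [heq]
    exact (h.isClosed_range_pow hN hM (Nat.le_succ d)).preimage continuous_subtype_val
  · have := hup.2
    have hmem : ∀ x : (T ^ d).range, (x : E) ∈ M := by
      rintro ⟨_, y, rfl⟩
      obtain ⟨m, hm⟩ := h.exists_pow_left_eq hN le_rfl y
      change (T ^ d) y ∈ M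
      rw [← hm]
      exact pow_mem_of_mapsTo h.mapsTo_left d m.2
    have hker : ∀ z : (rangeRestriction T d).ker, T (z : (T ^ d).range) = 0 := fun z =>
      congrArg Subtype.val z.2
    let j : (rangeRestriction T d).ker →ₗ[ℂ] (T.restrict h.mapsTo_left).ker :=
      { toFun := fun z => ⟨⟨(z : (T ^ d).range), hmem z⟩,
          Subtype.ext (hker z)⟩
        map_add' := fun _ _ => rfl
        map_smul' := fun _ _ => rfl }
    refine FiniteDimensional.of_injective j fun x y hxy => ?_
    exact Subtype.ext (Subtype.ext
      (congrArg (fun v : (T.restrict h.mapsTo_left).ker => ((v : M) : E)) hxy))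
  · have : FiniteDimensional ℂ (M ⧸ (T.restrict h.mapsTo_left).range) := hlow
    let p : M →ₗ[ℂ] (T ^ d).range := ((T ^ d : E →L[ℂ] E) : E →ₗ[ℂ] E).rangeRestrict ∘ₗ M.subtype
    let j := Submodule.mapQ (T.restrict h.mapsTo_left).range (rangeRestriction T d).range p (by
      rintro _ ⟨z, rfl⟩
      refine ⟨p z, Subtype.ext ?_⟩
      exact (pow_succ_apply T d z).symm.trans (pow_succ_apply' T d z))
    refine Module.Finite.of_surjective j fun x => ?_
    obtain ⟨⟨_, y, rfl⟩, rfl⟩ := Submodule.mkQ_surjective _ x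
    obtain ⟨m, hm⟩ := h.exists_pow_left_eq hN le_rfl y
    exact ⟨Submodule.Quotient.mk m, congrArg Submodule.Quotient.mk (Subtype.ext hm)⟩

theorem IsSemiFredholmSumNilpotent.isSemiBFredholm_and_isPseudoFredholm {T : E →L[ℂ] E}
    (hT : IsSemiFredholmSumNilpotent T) : IsSemiBFredholm T ∧ IsPseudoFredholm T := by
  obtain ⟨M, N, h, hM, hN⟩ := hT
  have hN' := (isNilpotent_restrict_iff _).mp hN
  have : CompleteSpace M := h.isClosed_left.completeSpace_coe
  obtain ⟨A, B, h', hA, hB⟩ := h.exists_isSemiRegular_refine hN' hM.exists_kato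
  obtain ⟨d, hd⟩ := hN'
  exact ⟨⟨d, h.isSemiBFredholmAt hd hM⟩, A, B, h', hA, IsNilpotent.isQuasiNilpotent hB⟩

theorem IsSemiBFredholm.isSemiFredholmSumNilpotent {T : E →L[ℂ] E} (hT : IsSemiBFredholm T)
    (hT' : IsPseudoFredholm T) : IsSemiFredholmSumNilpotent T := by
  obtain ⟨n, hn⟩ := hT
  obtain ⟨M, N, h, hM, hN⟩ := hT'
  exact ⟨M, N, h, hn.isSemiFredholm_left h hM, hn.isNilpotent_right h hN⟩

end Main

end FredholmTheory

theorem mainTheorem7 {X : Type*} [NormedAddCommGroup X] [NormedSpace ℂ X] [CompleteSpace X]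
    (T : X →L[ℂ] X) :
    ((FredholmTheory.IsSemiBFredholm T ∧ FredholmTheory.IsPseudoFredholm T) ↔
        FredholmTheory.IsSemiFredholmSumNilpotent T) ∧
      (FredholmTheory.IsSemiBFredholm T ∧ FredholmTheory.IsPseudoFredholm T →
        FredholmTheory.IsPseudoSemiBFredholm T ∧
          ∃ k : EReal,
            (∀ j : EReal, FredholmTheory.IsSemiBFredholmIndex T j ↔ j = k) ∧
            (∀ j : EReal, FredholmTheory.IsPseudoSemiBFredholmIndex T j ↔ j = k)) := by
  refine ⟨⟨fun h => h.1.isSemiFredholmSumNilpotent h.2,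
    fun h => h.isSemiBFredholm_and_isPseudoFredholm⟩, fun hT => ?_⟩
  obtain ⟨M, N, h, hM, hN⟩ := hT.1.isSemiFredholmSumNilpotent hT.2
  have hQ := FredholmTheory.IsNilpotent.isQuasiNilpotent hN
  obtain ⟨n, hn⟩ := hT.1
  have hB : FredholmTheory.IsSemiBFredholmIndex T _ := ⟨n, hn, rfl⟩
  have hP : FredholmTheory.IsPseudoSemiBFredholmIndex T _ := ⟨M, N, h, hM, hQ, rfl⟩
  have heq := FredholmTheory.eq_of_eventually_index_eq hB.eventually_eq hP.eventually_eq
  refine ⟨⟨M, N, h, hM, hQ⟩, _, fun j => ⟨fun hj => ?_, fun hj => hj ▸ hB⟩,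
    fun j => ⟨fun hj => ?_, fun hj => ?_⟩⟩
  · exact FredholmTheory.eq_of_eventually_index_eq hj.eventually_eq hB.eventually_eq
  · exact FredholmTheory.eq_of_eventually_index_eq hj.eventually_eq hB.eventually_eq
  · rw [hj, heq]
    exact hP
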